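/- Let $\alpha\in(0,1)$, $\sigma>0$, $\varepsilon>0$ and $l<u$ be real constants, and let $C_\varepsilon=\frac{e^\varepsilon+1}{e^\varepsilon-1}$, $t(y)=\max(l,\min(u,y))$, $\rho_\alpha(\tau)=(\alpha-1)\tau$ for $\tau\le 0$ and $\rho_\alpha(\tau)=\alpha\tau$ for $\tau>0$. For $\theta\in\mathbb R$ let $F_\theta$ be the asymmetric Laplace distribution with location $\theta$, i.e. with density $f_\theta(y)=\frac{\alpha(1-\alpha)}{\sigma}\exp\left(-\rho_\alpha\left(\frac{y-\theta}{\sigma}\right)\right)$, and let $$\Psi_\varepsilon(\theta)=\int\left(\frac12+\frac{t(y)-\frac{u+l}{2}}{(u-l)C_\varepsilon}\right)dF_\theta(y).$$ Let $F_X$ be a probability distribution on $\mathbb R^d$ with $\mathbb E\|X\|^2<\infty$ that has a density $f_X$ with respect to some measure, with $\log f_X$ integrable under $F_X$. Let $B\subset\mathbb R^d$ be compact and let $\beta^*$ be an interior point of $B$. Let $(X_i,Y_i,Z_i)$, $i=1,2,\dots$, be independent copies of $(X,Y,Z)$, where $X\sim F_X$, $Y$ given $X=x$ has distribution $F_{\langle\beta^*,x\rangle}$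 (the model is correctly specified), and, given $(X,Y)$, $Z\in\{0,1\}$ equals $1$ with probability $\frac12+\frac{t(Y)-(u+l)/2}{(u-l)C_\varepsilon}$ (the bit flip of the truncated value). For $\beta\in B$ put $$\log p_\beta(x,z)=z\log\Psi_\varepsilon(\langle\beta,x\rangle)+(1-z)\log\bigl(1-\Psi_\varepsilon(\langle\beta,x\rangle)\bigr)+\log f_X(x),$$ and assume that $\beta\mapsto\mathbb E[\log p_\beta(X,Z)]$ has a unique maximizer over $B$. Let $\hat\beta_n$ be a maximum likelihood estimator, i.e. a random vector that almost surely maximizes $\frac1n\sum_{i=1}^n\log p_\beta(X_i,Z_i)$ over $\beta\in B$. Then the matrix $$I_{\beta^*}=\mathbb E\left[\frac{\Psi_\varepsilon'(\langle\beta^*,X\rangle)^2}{\Psi_\varepsilon(\langle\beta^*,X\rangle)\bigl(1-\Psi_\varepsilon(\langle\beta^*,X\rangle)\bigr)}\,XX^\top\right]$$ is well defined (its entries are integrals of integrable functions) and positive definite, and $$\sqrt n\,(\hat\beta_n-\beta^*)\to\mathcal N(0,I_{\beta^*}^{-1})\quad\text{in distribution as } n\to\infty.$$ -/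

import Mathlib

open MeasureTheory ProbabilityTheory Filter
open scoped ENNReal Topology

namespace OneBitQuantile

noncomputable section

/-! ### The asymmetric Laplace distribution -/

/-- The check loss `ρ_α`. -/
def checkLoss (α τ : ℝ) : ℝ := if τ ≤ 0 then (α - 1) * τ else α * τ

/-- Density at `y` of the asymmetric Laplace distribution with skewness `α`, location `θ` and
scale `σ`. -/
def aldPDF (α σ θ y : ℝ) : ℝ :=
  α * (1 - α) / σ * Real.exp (-checkLoss α ((y - θ) / σ))

lemma measurable_checkLoss (α : ℝ) : Measurable (checkLoss α) :=
  Measurable.ite measurableSet_Iic (by fun_prop) (by fun_prop)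

lemma measurable_aldPDF (α σ : ℝ) :
    Measurable (Function.uncurry fun θ y => ENNReal.ofReal (aldPDF α σ θ y)) := by
  have h : Measurable fun p : ℝ × ℝ => checkLoss α ((p.2 - p.1) / σ) :=
    (measurable_checkLoss α).comp (by fun_prop)
  unfold aldPDF Function.uncurry
  fun_prop

/-- The asymmetric Laplace distribution, as a kernel in its location `θ`. -/
def aldKernel (α σ : ℝ) : Kernel ℝ ℝ :=
  Kernel.withDensity (Kernel.const ℝ volume) fun θ y => ENNReal.ofReal (aldPDF α σ θ y)

lemma aldKernel_apply (α σ θ : ℝ) :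
    aldKernel α σ θ = volume.withDensity fun y => ENNReal.ofReal (aldPDF α σ θ y) := by
  rw [aldKernel, Kernel.withDensity_apply _ (measurable_aldPDF α σ), Kernel.const_apply]

/-! ### Truncation and the bit flip -/

/-- Truncation of `y` to `[l, u]`. -/
def trunc (l u y : ℝ) : ℝ := max l (min u y)

/-- `C_ε = (e^ε + 1) / (e^ε - 1)`. -/
def flipConst (ε : ℝ) : ℝ := (Real.exp ε + 1) / (Real.exp ε - 1)

/-- Probability that the bit flip with privacy level `ε` outputs `z` on input `v ∈ [l, u]`. -/
def bitFlip (ε l u v : ℝ) (z : Bool) : ℝ :=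
  if z then 1 / 2 + (v - (u + l) / 2) / ((u - l) * flipConst ε)
  else 1 / 2 - (v - (u + l) / 2) / ((u - l) * flipConst ε)

lemma measurable_bitFlip (ε l u : ℝ) :
    Measurable (Function.uncurry fun y z =>
      ENNReal.ofReal (bitFlip ε l u (trunc l u y) z)) := by
  refine measurable_from_prod_countable_left fun z => ?_
  cases z <;> simp only [Function.uncurry, bitFlip, trunc, Bool.false_eq_true, if_true, if_false] <;>
    fun_prop

/-- The user's mechanism: truncate `y` to `[l, u]`, then apply the bit flip. -/
def mechanism (ε l u : ℝ) : Kernel ℝ Bool :=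
  Kernel.withDensity (Kernel.const ℝ Measure.count) fun y z =>
    ENNReal.ofReal (bitFlip ε l u (trunc l u y) z)

lemma mechanism_apply (ε l u y : ℝ) :
    mechanism ε l u y =
      Measure.count.withDensity fun z => ENNReal.ofReal (bitFlip ε l u (trunc l u y) z) := by
  rw [mechanism, Kernel.withDensity_apply _ (measurable_bitFlip ε l u), Kernel.const_apply]

/-! ### The model and the data -/

/-- `Ψ_ε(θ)`: probability that the submitted bit is `1` when `Y` is asymmetric Laplace with
location `θ`. -/
def Psi (α σ ε l u θ : ℝ) : ℝ :=
  ∫ y, bitFlip ε l u (trunc l u y) true ∂(aldKernel α σ θ)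

variable {d : ℕ}

/-- Joint law of `(X, Y, Z)` when `X ∼ FX`, `Y` given `X = x` is asymmetric Laplace with
location `⟨β, x⟩`, and `Z` is the output of the user's mechanism on `Y`. -/
def jointLaw (α σ ε l u : ℝ) (FX : Measure (EuclideanSpace ℝ (Fin d)))
    (β : EuclideanSpace ℝ (Fin d)) : Measure (EuclideanSpace ℝ (Fin d) × ℝ × Bool) :=
  FX ⊗ₘ ((aldKernel α σ).comap (fun x => inner ℝ β x) (by fun_prop) ⊗ₖ
    (mechanism ε l u).comap Prod.snd measurable_snd)

/-- Joint law of the observation `(X, Z)` seen by the curator. -/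
def obsLaw (α σ ε l u : ℝ) (FX : Measure (EuclideanSpace ℝ (Fin d)))
    (β : EuclideanSpace ℝ (Fin d)) : Measure (EuclideanSpace ℝ (Fin d) × Bool) :=
  (jointLaw α σ ε l u FX β).map fun w => (w.1, w.2.2)

/-- `Λ_ε(β, x) = p_β(z = 1 | x)`. -/
def Lam (α σ ε l u : ℝ) (β x : EuclideanSpace ℝ (Fin d)) : ℝ :=
  Psi α σ ε l u (inner ℝ β x)

/-- Logarithm of the model density `p_β(x, z) = p_β(z | x) f_X(x)` of an observation. -/
def logDensity (α σ ε l u : ℝ) (fX : EuclideanSpace ℝ (Fin d) → ℝ)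
    (β x : EuclideanSpace ℝ (Fin d)) (z : Bool) : ℝ :=
  (if z then Real.log (Lam α σ ε l u β x) else Real.log (1 - Lam α σ ε l u β x))
    + Real.log (fX x)

/-- The log-likelihood `ℓ(β; D_n)` of the first `n` observations. -/
def logLik (α σ ε l u : ℝ) (fX : EuclideanSpace ℝ (Fin d) → ℝ) (n : ℕ)
    (x : ℕ → EuclideanSpace ℝ (Fin d)) (z : ℕ → Bool) (β : EuclideanSpace ℝ (Fin d)) : ℝ :=
  (1 / (n : ℝ)) * ∑ i ∈ Finset.range n, logDensity α σ ε l u fX β (x i) (z i)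

/-- The expected log-likelihood `P log p_β` under an observation law `P`. -/
def expLogLik (α σ ε l u : ℝ) (fX : EuclideanSpace ℝ (Fin d) → ℝ)
    (P : Measure (EuclideanSpace ℝ (Fin d) × Bool)) (β : EuclideanSpace ℝ (Fin d)) : ℝ :=
  ∫ w, logDensity α σ ε l u fX β w.1 w.2 ∂P

/-- The integrand `Ψ_ε'(⟨β,x⟩)² / (Ψ_ε(⟨β,x⟩) (1 - Ψ_ε(⟨β,x⟩))) · x_j x_k` of the Fisher
information. -/
def fisherIntegrand (α σ ε l u : ℝ) (β : EuclideanSpace ℝ (Fin d)) (j k : Fin d)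
    (x : EuclideanSpace ℝ (Fin d)) : ℝ :=
  deriv (Psi α σ ε l u) (inner ℝ β x) ^ 2 /
    (Psi α σ ε l u (inner ℝ β x) * (1 - Psi α σ ε l u (inner ℝ β x))) * (x j * x k)

/-- The Fisher information matrix at `β`. -/
def fisherInfo (α σ ε l u : ℝ) (FX : Measure (EuclideanSpace ℝ (Fin d)))
    (β : EuclideanSpace ℝ (Fin d)) : Matrix (Fin d) (Fin d) ℝ :=
  Matrix.of fun j k => ∫ x, fisherIntegrand α σ ε l u β j k x ∂FX

end

end OneBitQuantile

/-!
The proof is the classical linearization argument for `M`-estimators, arranged so that two moments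
of the covariates suffice.

*The response function.* Moving the location of the asymmetric Laplace law only translates the
argument of the truncation map, so `Psi` is differentiable with derivative the slope of the bit flip
times the probability of the interval between the truncation points; this is positive, and
differentiable in turn because the density is continuous (`hasDerivAt_Psi`, `derivPsi_pos`,
`hasDerivAt_derivPsi`). As `C_ε > 1`, `Psi` stays away from `0` and `1`. Hence the log-probability
`bitLog` of a bit, its derivative `bitScore` and its second derivative `bitHess` are bounded and
Lipschitz functions of the linear predictor.

*Identification.* By Gibbs' inequality the true parameter maximizes the expected log-likelihood
(`expLogLik_le`), so it is the unique maximizer. A vector in the kernel of the Fisher information is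
orthogonal to almost every covariate vector, and moving along it would produce further maximizers;
hence the Fisher information is positive definite (`posDef_fisherInfo`).

*Consistency.* The average log-likelihoods are Lipschitz in the parameter with a constant
proportional to the average of `‖X i‖`, and by the strong law they converge on a countable dense
subset of the compact parameter set; a cluster point of the estimators therefore maximizes the
expected log-likelihood (`tendsto_of_isMaxOn`, `tendsto_mle`).

*Normality.* Once the estimator is an interior point, the likelihood equation holds. Its Taylor
expansion at the true parameter has the average Hessian as linear part, which converges to minus the
Fisher information by the information equality and the strong law, and a remainder bounded by
`‖Δ‖` times the average of `K min(2, ‖Δ‖ ‖X i‖) ‖X i‖ ^ 2`, which is `o(‖Δ‖)` almost surely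
(`norm_score_add_hess_le`, `tendsto_averageRemainder`). So `√n Δ` differs from the normalized sum of
the scores, premultiplied by the inverse Fisher information, by a relative error that vanishes
almost surely. The central limit theorem (from the one-dimensional theorem through the Cramér–Wold
device) and Slutsky's theorem conclude.
-/

namespace OneBitQuantile

/-! ### Bounded Lipschitz functions -/

/-- The real function `f` is bounded and Lipschitz; one constant serves for both. -/
def IsBddLip (f : ℝ → ℝ) : Prop :=
  ∃ K, (∀ x, |f x| ≤ K) ∧ ∀ x y, |f x - f y| ≤ K * |x - y|

namespace IsBddLip

variable {f g : ℝ → ℝ}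

lemma of_bounds {K L : ℝ} (hK : ∀ x, |f x| ≤ K) (hL : ∀ x y, |f x - f y| ≤ L * |x - y|) :
    IsBddLip f :=
  ⟨max K L, fun x => (hK x).trans (le_max_left _ _), fun x y =>
    (hL x y).trans (mul_le_mul_of_nonneg_right (le_max_right _ _) (abs_nonneg _))⟩

lemma of_hasDerivAt {f' : ℝ → ℝ} {K : ℝ} (hK : ∀ x, |f x| ≤ K)
    (hf : ∀ x, HasDerivAt f (f' x) x) (hf' : IsBddLip f') : IsBddLip f := by
  obtain ⟨L, hL, -⟩ := hf'
  refine of_bounds hK (L := L) fun x y => ?_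
  have := Convex.norm_image_sub_le_of_norm_hasDerivWithin_le (s := Set.univ) (f := f)
    (fun z _ => (hf z).hasDerivWithinAt) (fun z _ => hL z) convex_univ
    (Set.mem_univ y) (Set.mem_univ x)
  simpa using this

lemma sub (hf : IsBddLip f) (hg : IsBddLip g) : IsBddLip fun x => f x - g x := by
  obtain ⟨K, hK, hK'⟩ := hf
  obtain ⟨L, hL, hL'⟩ := hg
  refine ⟨K + L, fun x => ?_, fun x y => ?_⟩
  · exact (abs_sub _ _).trans (add_le_add (hK x) (hL x))
  · calc |f x - g x - (f y - g y)| = |(f x - f y) - (g x - g y)| := by congr 1; ring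
      _ ≤ |f x - f y| + |g x - g y| := abs_sub _ _
      _ ≤ (K + L) * |x - y| := by rw [add_mul]; exact add_le_add (hK' x y) (hL' x y)

lemma mul (hf : IsBddLip f) (hg : IsBddLip g) : IsBddLip fun x => f x * g x := by
  obtain ⟨K, hK, hK'⟩ := hf
  obtain ⟨L, hL, hL'⟩ := hg
  have hK0 : 0 ≤ K := (abs_nonneg _).trans (hK 0)
  have hL0 : 0 ≤ L := (abs_nonneg _).trans (hL 0)
  refine of_bounds (K := K * L) (L := K * L + L * K) (fun x => ?_) fun x y => ?_
  · rw [abs_mul]; exact mul_le_mul (hK x) (hL x) (abs_nonneg _) hK0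
  · calc |f x * g x - f y * g y| = |f x * (g x - g y) + g y * (f x - f y)| := by congr 1; ring
      _ ≤ |f x| * |g x - g y| + |g y| * |f x - f y| := by
        rw [← abs_mul, ← abs_mul]; exact abs_add_le _ _
      _ ≤ K * (L * |x - y|) + L * (K * |x - y|) := by
        gcongr
        exacts [hK x, hL' x y, hL y, hK' x y]
      _ = _ := by ring

lemma const (c : ℝ) : IsBddLip fun _ => c :=
  of_bounds (K := |c|) (L := 0) (fun _ => le_rfl) (by simp)

lemma neg (hf : IsBddLip f) : IsBddLip fun x => -f x := by
  simpa using (const 0).sub hf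

lemma inv (hf : IsBddLip f) {c : ℝ} (hc : 0 < c) (hcf : ∀ x, c ≤ f x) :
    IsBddLip fun x => (f x)⁻¹ := by
  obtain ⟨K, -, hK'⟩ := hf
  have hpos x : 0 < f x := hc.trans_le (hcf x)
  refine of_bounds (K := c⁻¹) (L := K * (c⁻¹ * c⁻¹)) (fun x => ?_) fun x y => ?_
  · rw [abs_of_pos (inv_pos.2 (hpos x))]
    exact inv_anti₀ hc (hcf x)
  · rw [inv_sub_inv (hpos x).ne' (hpos y).ne', abs_div, abs_sub_comm,
      abs_of_pos (mul_pos (hpos x) (hpos y)), div_eq_mul_inv, mul_inv]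
    calc |f x - f y| * ((f x)⁻¹ * (f y)⁻¹) ≤ (K * |x - y|) * (c⁻¹ * c⁻¹) := by
          gcongr
          · exact (mul_pos (inv_pos.2 (hpos x)) (inv_pos.2 (hpos y))).le
          · exact (abs_nonneg _).trans (hK' x y)
          · exact hK' x y
          · exact (inv_pos.2 (hpos y)).le
          · exact hcf x
          · exact hcf y
      _ = _ := by ring

lemma div (hf : IsBddLip f) (hg : IsBddLip g) {c : ℝ} (hc : 0 < c) (hcg : ∀ x, c ≤ g x) :
    IsBddLip fun x => f x / g x := by
  simpa only [div_eq_mul_inv] using hf.mul (hg.inv hc hcg)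

lemma comp_const_sub (hf : IsBddLip f) (a : ℝ) : IsBddLip fun x => f (a - x) := by
  obtain ⟨K, hK, hK'⟩ := hf
  refine ⟨K, fun x => hK _, fun x y => (hK' _ _).trans_eq ?_⟩
  rw [sub_sub_sub_cancel_left, abs_sub_comm]

lemma continuous (hf : IsBddLip f) : Continuous f := by
  obtain ⟨K, hK, hK'⟩ := hf
  have hK0 : 0 ≤ K := (abs_nonneg _).trans (hK 0)
  exact (LipschitzWith.of_dist_le_mul (K := ⟨K, hK0⟩) hK').continuous

end IsBddLip

/-! ### The asymmetric Laplace density -/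

section Density

variable {α σ : ℝ}

lemma checkLoss_eq_max (τ : ℝ) :
    checkLoss α τ = max ((α - 1) * τ) (α * τ) := by
  unfold checkLoss
  split_ifs with h
  · rw [max_eq_left]; nlinarith
  · rw [max_eq_right]; nlinarith

lemma checkLoss_nonneg (hα0 : 0 < α) (hα1 : α < 1) (τ : ℝ) : 0 ≤ checkLoss α τ := by
  unfold checkLoss
  split_ifs with h
  · nlinarith
  · have := not_le.1 h; positivity

lemma abs_checkLoss_sub_le (hα0 : 0 < α) (hα1 : α < 1) (a b : ℝ) :
    |checkLoss α a - checkLoss α b| ≤ |a - b| := by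
  rw [checkLoss_eq_max, checkLoss_eq_max]
  refine (abs_max_sub_max_le_max _ _ _ _).trans (max_le ?_ ?_)
  · rw [← mul_sub, abs_mul]
    exact mul_le_of_le_one_left (abs_nonneg _) (by rw [abs_le]; constructor <;> linarith)
  · rw [← mul_sub, abs_mul]
    exact mul_le_of_le_one_left (abs_nonneg _) (by rw [abs_le]; constructor <;> linarith)

lemma aldPDF_pos (hα0 : 0 < α) (hα1 : α < 1) (hσ : 0 < σ) (θ y : ℝ) : 0 < aldPDF α σ θ y := by
  have : 0 < 1 - α := by linarith
  unfold aldPDF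
  positivity

lemma aldPDF_eq_zero_sub (θ y : ℝ) : aldPDF α σ θ y = aldPDF α σ 0 (y - θ) := by
  simp [aldPDF]

lemma isBddLip_aldPDF (hα0 : 0 < α) (hα1 : α < 1) (hσ : 0 < σ) : IsBddLip (aldPDF α σ 0) := by
  have hc : 0 ≤ 1 - α := by linarith
  refine IsBddLip.mul (IsBddLip.const _) (IsBddLip.of_bounds (K := 1) (L := σ⁻¹) ?_ ?_)
  · intro y
    rw [Real.abs_exp, Real.exp_le_one_iff]
    linarith [checkLoss_nonneg hα0 hα1 ((y - 0) / σ)]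
  · have key : ∀ a b : ℝ, 0 ≤ a → a ≤ b → |Real.exp (-a) - Real.exp (-b)| ≤ |a - b| := by
      intro a b ha hab
      rw [abs_of_nonneg (by simpa using hab), abs_sub_comm, abs_of_nonneg (by linarith)]
      have h1 : Real.exp (-b) = Real.exp (-a) * Real.exp (-(b - a)) := by
        rw [← Real.exp_add]; ring_nf
      have h2 : 1 - Real.exp (-(b - a)) ≤ b - a := by linarith [Real.add_one_le_exp (-(b - a))]
      have h3 : Real.exp (-a) ≤ 1 := by rw [Real.exp_le_one_iff]; linarith
      rw [h1, ← mul_one_sub]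
      calc _ ≤ Real.exp (-a) * (b - a) := by gcongr
        _ ≤ _ := mul_le_of_le_one_left (by linarith) h3
    intro x y
    have hx := checkLoss_nonneg hα0 hα1 ((x - 0) / σ)
    have hy := checkLoss_nonneg hα0 hα1 ((y - 0) / σ)
    have hl := abs_checkLoss_sub_le hα0 hα1 ((x - 0) / σ) ((y - 0) / σ)
    have he : |(x - 0) / σ - (y - 0) / σ| = σ⁻¹ * |x - y| := by
      rw [← sub_div, abs_div, abs_of_pos hσ, sub_zero, sub_zero, div_eq_inv_mul]
    rw [← he]
    rcases le_total (checkLoss α ((x - 0) / σ)) (checkLoss α ((y - 0) / σ)) with h | h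
    · exact (key _ _ hx h).trans hl
    · rw [abs_sub_comm]
      exact (key _ _ hy h).trans ((abs_sub_comm _ _).trans_le hl)

lemma continuous_aldPDF (hα0 : 0 < α) (hα1 : α < 1) (hσ : 0 < σ) : Continuous (aldPDF α σ 0) :=
  (isBddLip_aldPDF hα0 hα1 hσ).continuous

lemma integrable_integral_aldPDF_zero (hα0 : 0 < α) (hα1 : α < 1) (hσ : 0 < σ) :
    Integrable (aldPDF α σ 0) ∧ ∫ y, aldPDF α σ 0 y = 1 := by
  have h1α : 0 < 1 - α := by linarith
  have e1 : Set.EqOn (aldPDF α σ 0)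
      (fun y => α * (1 - α) / σ * Real.exp ((1 - α) / σ * y)) (Set.Iic 0) := by
    intro y hy
    have : y / σ ≤ 0 := div_nonpos_of_nonpos_of_nonneg hy hσ.le
    simp only [aldPDF, checkLoss, sub_zero, if_pos this]
    ring_nf
  have e2 : Set.EqOn (aldPDF α σ 0)
      (fun y => α * (1 - α) / σ * Real.exp (-(α / σ) * y)) (Set.Ioi 0) := by
    intro y hy
    have : ¬ y / σ ≤ 0 := not_le.2 (div_pos hy hσ)
    simp only [aldPDF, checkLoss, sub_zero, if_neg this]
    ring_nf
  have i1 : IntegrableOn (aldPDF α σ 0) (Set.Iic 0) := by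
    rw [integrableOn_congr_fun e1 measurableSet_Iic]
    exact (integrableOn_exp_mul_Iic (by positivity) 0).const_mul _
  have i2 : IntegrableOn (aldPDF α σ 0) (Set.Ioi 0) := by
    rw [integrableOn_congr_fun e2 measurableSet_Ioi]
    exact (integrableOn_exp_mul_Ioi (by simpa using div_pos hα0 hσ) 0).const_mul _
  have hu : IntegrableOn (aldPDF α σ 0) Set.univ := by
    rw [← Set.Iic_union_Ioi (a := (0 : ℝ))]; exact i1.union i2
  refine ⟨integrableOn_univ.1 hu, ?_⟩
  rw [← intervalIntegral.integral_Iic_add_Ioi i1 i2, setIntegral_congr_fun measurableSet_Iic e1,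
    setIntegral_congr_fun measurableSet_Ioi e2, integral_const_mul, integral_const_mul,
    integral_exp_mul_Iic (by positivity), integral_exp_mul_Ioi (by simpa using div_pos hα0 hσ)]
  simp
  field_simp
  ring

lemma integrable_aldPDF (hα0 : 0 < α) (hα1 : α < 1) (hσ : 0 < σ) (θ : ℝ) :
    Integrable (aldPDF α σ θ) := by
  simp_rw [funext (aldPDF_eq_zero_sub (α := α) (σ := σ) θ)]
  exact (integrable_integral_aldPDF_zero hα0 hα1 hσ).1.comp_sub_right θ

lemma integral_aldPDF (hα0 : 0 < α) (hα1 : α < 1) (hσ : 0 < σ) (θ : ℝ) :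
    ∫ y, aldPDF α σ θ y = 1 := by
  simp_rw [aldPDF_eq_zero_sub (α := α) (σ := σ) θ]
  rw [integral_sub_right_eq_self (aldPDF α σ 0) θ]
  exact (integrable_integral_aldPDF_zero hα0 hα1 hσ).2

lemma isMarkovKernel_aldKernel (hα0 : 0 < α) (hα1 : α < 1) (hσ : 0 < σ) :
    IsMarkovKernel (aldKernel α σ) := by
  refine ⟨fun θ => ⟨?_⟩⟩
  rw [aldKernel_apply, withDensity_apply _ MeasurableSet.univ, Measure.restrict_univ,
    ← ofReal_integral_eq_lintegral_ofReal (integrable_aldPDF hα0 hα1 hσ θ)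
      (ae_of_all _ fun y => (aldPDF_pos hα0 hα1 hσ θ y).le), integral_aldPDF hα0 hα1 hσ,
    ENNReal.ofReal_one]

end Density

/-! ### The bit flip and the response function `Ψ_ε` -/

section Response

variable {α σ ε l u : ℝ}

lemma one_lt_flipConst (hε : 0 < ε) : 1 < flipConst ε := by
  have : 1 < Real.exp ε := Real.one_lt_exp_iff.2 hε
  rw [flipConst, lt_div_iff₀ (by linarith)]
  linarith

/-- Slope of the affine map that sends a truncated value to the probability of the bit `1`. -/
noncomputable def flipSlope (ε l u : ℝ) : ℝ := ((u - l) * flipConst ε)⁻¹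

lemma flipSlope_pos (hε : 0 < ε) (hlu : l < u) : 0 < flipSlope ε l u := by
  have := one_lt_flipConst hε
  exact inv_pos.2 (mul_pos (by linarith) (by linarith))

lemma bitFlip_true (v : ℝ) :
    bitFlip ε l u v true = 1 / 2 + flipSlope ε l u * (v - (u + l) / 2) := by
  simp [bitFlip, flipSlope, div_eq_inv_mul]

lemma bitFlip_false (v : ℝ) : bitFlip ε l u v false = 1 - bitFlip ε l u v true := by
  simp [bitFlip]; ring

lemma bitFlip_trunc_mem (hε : 0 < ε) (hlu : l < u) (y : ℝ) :
    bitFlip ε l u (trunc l u y) true ∈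
      Set.Icc ((1 - (flipConst ε)⁻¹) / 2) (1 - (1 - (flipConst ε)⁻¹) / 2) := by
  have hs := flipSlope_pos hε hlu
  have hC := one_lt_flipConst hε
  have h1 : l ≤ trunc l u y := le_max_left _ _
  have h2 : trunc l u y ≤ u := max_le hlu.le (min_le_left _ _)
  have h3 : flipSlope ε l u * (u - l) = (flipConst ε)⁻¹ := by
    have : u - l ≠ 0 := by linarith
    rw [flipSlope, mul_inv]; field_simp
  rw [bitFlip_true]
  constructor <;> nlinarith

lemma lipschitzWith_trunc : LipschitzWith 1 (trunc l u) := by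
  simpa [trunc] using! (LipschitzWith.id.const_min u).const_max l

/-- Truncation is differentiable away from the two corners. -/
lemma hasDerivAt_trunc (hlu : l < u) {y : ℝ} (hl : y ≠ l) (hu : y ≠ u) :
    HasDerivAt (trunc l u) ((Set.Ioo l u).indicator (fun _ => 1) y) y := by
  rcases lt_or_gt_of_ne hl with h | h
  · rw [Set.indicator_of_notMem (fun hy => (lt_asymm hy.1 h))]
    refine (hasDerivAt_const y l).congr_of_eventuallyEq ?_
    filter_upwards [Iio_mem_nhds h] with z hz
    exact max_eq_left ((min_le_right _ _).trans (le_of_lt hz))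
  rcases lt_or_gt_of_ne hu with h' | h'
  · rw [Set.indicator_of_mem (show y ∈ Set.Ioo l u from ⟨h, h'⟩)]
    refine (hasDerivAt_id y).congr_of_eventuallyEq ?_
    filter_upwards [Ioo_mem_nhds h h'] with z hz
    simp [trunc, hz.1.le, hz.2.le]
  · rw [Set.indicator_of_notMem (fun hy => (lt_asymm hy.2 h'))]
    refine (hasDerivAt_const y u).congr_of_eventuallyEq ?_
    filter_upwards [Ioi_mem_nhds h'] with z hz
    rw [trunc, min_eq_left (le_of_lt hz), max_eq_right hlu.le]

lemma continuous_bitFlip_trunc : Continuous fun y => bitFlip ε l u (trunc l u y) true := by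
  simp_rw [bitFlip_true]
  exact continuous_const.add (continuous_const.mul (lipschitzWith_trunc.continuous.sub
    continuous_const))

lemma integrable_bitFlip_trunc [IsMarkovKernel (aldKernel α σ)] (hε : 0 < ε) (hlu : l < u)
    (θ : ℝ) : Integrable (fun y => bitFlip ε l u (trunc l u y) true) (aldKernel α σ θ) :=
  Integrable.of_mem_Icc _ _ continuous_bitFlip_trunc.measurable.aemeasurable
    (ae_of_all _ (bitFlip_trunc_mem hε hlu))

/-- `Ψ_ε` takes its values in a compact subinterval of `(0, 1)`, because `C_ε > 1`. -/
lemma Psi_mem [IsMarkovKernel (aldKernel α σ)] (hε : 0 < ε) (hlu : l < u) (θ : ℝ) :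
    Psi α σ ε l u θ ∈
      Set.Icc ((1 - (flipConst ε)⁻¹) / 2) (1 - (1 - (flipConst ε)⁻¹) / 2) := by
  have hi := integrable_bitFlip_trunc (α := α) (σ := σ) hε hlu θ
  constructor
  · have := integral_mono (integrable_const _) hi fun y => (bitFlip_trunc_mem hε hlu y).1
    simpa [Psi] using this
  · have := integral_mono hi (integrable_const _) fun y => (bitFlip_trunc_mem hε hlu y).2
    simpa [Psi] using this

/-- `Ψ_ε` as an integral against the density at location `0`, in which the parameter only moves
the Lipschitz truncation map. -/
lemma Psi_eq_integral (hα0 : 0 < α) (hα1 : α < 1) (hσ : 0 < σ) (θ : ℝ) :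
    Psi α σ ε l u θ =
      ∫ y, aldPDF α σ 0 y * bitFlip ε l u (trunc l u (y + θ)) true := by
  have hm : Measurable (aldPDF α σ θ) := by
    rw [funext (aldPDF_eq_zero_sub (α := α) (σ := σ) θ)]
    exact (continuous_aldPDF hα0 hα1 hσ).measurable.comp (measurable_id.sub_const θ)
  rw [Psi, aldKernel_apply, integral_withDensity_eq_integral_toReal_smul hm.ennreal_ofReal
    (ae_of_all _ fun _ => ENNReal.ofReal_lt_top),
    ← integral_add_right_eq_self _ θ]
  refine integral_congr_ae (ae_of_all _ fun y => ?_)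
  simp only [smul_eq_mul]
  rw [ENNReal.toReal_ofReal (aldPDF_pos hα0 hα1 hσ _ _).le, aldPDF_eq_zero_sub,
    add_sub_cancel_right]

/-- The derivative of `Ψ_ε`: the slope of the bit flip times the probability that the response
falls between the truncation points. -/
noncomputable def derivPsi (α σ ε l u θ : ℝ) : ℝ :=
  flipSlope ε l u * ∫ y in (l - θ)..(u - θ), aldPDF α σ 0 y

/-- The second derivative of `Ψ_ε`. -/
noncomputable def derivPsi₂ (α σ ε l u θ : ℝ) : ℝ :=
  flipSlope ε l u * (aldPDF α σ 0 (l - θ) - aldPDF α σ 0 (u - θ))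

lemma hasDerivAt_Psi (hα0 : 0 < α) (hα1 : α < 1) (hσ : 0 < σ) (hε : 0 < ε) (hlu : l < u) (θ : ℝ) :
    HasDerivAt (Psi α σ ε l u) (derivPsi α σ ε l u θ) θ := by
  have hs := flipSlope_pos hε hlu
  have hint := (integrable_integral_aldPDF_zero hα0 hα1 hσ).1
  have hcont := continuous_aldPDF hα0 hα1 hσ
  have hpos := aldPDF_pos hα0 hα1 hσ 0
  have hF_meas (θ : ℝ) : Continuous fun y =>
      aldPDF α σ 0 y * bitFlip ε l u (trunc l u (y + θ)) true :=
    hcont.mul (continuous_bitFlip_trunc.comp (continuous_id.add continuous_const))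
  have hbd : ∀ y, ‖bitFlip ε l u (trunc l u (y + θ)) true‖ ≤ 1 := fun y => by
    have h := bitFlip_trunc_mem hε hlu (y + θ)
    have hC := one_lt_flipConst hε
    have hC' : (flipConst ε)⁻¹ < 1 := inv_lt_one_of_one_lt₀ hC
    rw [Real.norm_eq_abs, abs_le]; constructor <;> linarith [h.1, h.2]
  have key := (hasDerivAt_integral_of_dominated_loc_of_lip (μ := volume) (s := Set.univ)
    (F := fun θ y => aldPDF α σ 0 y * bitFlip ε l u (trunc l u (y + θ)) true)
    (F' := fun y => aldPDF α σ 0 y *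
      (flipSlope ε l u * (Set.Ioo l u).indicator (fun _ => 1) (y + θ)))
    (bound := fun y => aldPDF α σ 0 y * flipSlope ε l u) (x₀ := θ) univ_mem
    (Eventually.of_forall fun θ => (hF_meas θ).aestronglyMeasurable)
    (hint.mul_bdd (c := 1) (continuous_bitFlip_trunc.comp
      (continuous_id.add continuous_const)).aestronglyMeasurable (ae_of_all _ hbd))
    ?_ ?_ (hint.mul_const _) ?_).2
  · have e : (∫ y, aldPDF α σ 0 y *
        (flipSlope ε l u * (Set.Ioo l u).indicator (fun _ => 1) (y + θ))) =
        derivPsi α σ ε l u θ := by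
      rw [derivPsi, intervalIntegral.integral_of_le (by linarith), integral_Ioc_eq_integral_Ioo,
        ← integral_indicator measurableSet_Ioo, ← integral_const_mul]
      refine integral_congr_ae (ae_of_all _ fun y => ?_)
      by_cases hy : y ∈ Set.Ioo (l - θ) (u - θ)
      · have : y + θ ∈ Set.Ioo l u := ⟨by linarith [hy.1], by linarith [hy.2]⟩
        simp [hy, this, mul_comm]
      · have : y + θ ∉ Set.Ioo l u := fun h => hy ⟨by linarith [h.1], by linarith [h.2]⟩
        simp [hy, this]
    rw [← e]
    refine key.congr_of_eventuallyEq (Eventually.of_forall fun θ' => ?_)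
    exact Psi_eq_integral hα0 hα1 hσ θ'
  · refine (hcont.measurable.mul (measurable_const.mul ?_)).aestronglyMeasurable
    exact (measurable_const.indicator measurableSet_Ioo).comp (measurable_id.add_const θ)
  · refine ae_of_all _ fun y => LipschitzWith.lipschitzOnWith ?_
    refine LipschitzWith.of_dist_le_mul fun a b => ?_
    have h := lipschitzWith_trunc (l := l) (u := u) |>.dist_le_mul (y + a) (y + b)
    rw [Real.dist_eq, Real.dist_eq, add_sub_add_left_eq_sub, NNReal.coe_one, one_mul] at h
    rw [Real.dist_eq, Real.dist_eq, Real.coe_nnabs, bitFlip_true, bitFlip_true,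
      abs_of_pos (mul_pos (hpos y) hs), ← mul_sub, add_sub_add_left_eq_sub, ← mul_sub,
      sub_sub_sub_cancel_right, abs_mul, abs_mul, abs_of_pos (hpos y), abs_of_pos hs, mul_assoc]
    have := hpos y
    gcongr
  · have h1 : ∀ a : ℝ, ∀ᵐ y : ℝ, y + θ ≠ a := fun a => by
      filter_upwards [compl_mem_ae_iff.2 (measure_singleton (a - θ))] with y hy h
      exact hy (by simp [← h])
    filter_upwards [h1 l, h1 u] with y hyl hyu
    simp_rw [bitFlip_true]
    refine HasDerivAt.const_mul _ (HasDerivAt.const_add _ (HasDerivAt.const_mul _ ?_))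
    exact ((hasDerivAt_trunc hlu hyl hyu).comp_const_add y θ).sub_const _

lemma derivPsi_pos (hα0 : 0 < α) (hα1 : α < 1) (hσ : 0 < σ) (hε : 0 < ε) (hlu : l < u) (θ : ℝ) :
    0 < derivPsi α σ ε l u θ :=
  mul_pos (flipSlope_pos hε hlu) (intervalIntegral.intervalIntegral_pos_of_pos
    ((continuous_aldPDF hα0 hα1 hσ).intervalIntegrable _ _) (aldPDF_pos hα0 hα1 hσ 0)
    (by linarith))

lemma hasDerivAt_derivPsi (hα0 : 0 < α) (hα1 : α < 1) (hσ : 0 < σ) (θ : ℝ) :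
    HasDerivAt (derivPsi α σ ε l u) (derivPsi₂ α σ ε l u θ) θ := by
  have hcont := continuous_aldPDF hα0 hα1 hσ
  have hF (a : ℝ) : HasDerivAt (fun θ => ∫ y in (0 : ℝ)..(a - θ), aldPDF α σ 0 y)
      (-aldPDF α σ 0 (a - θ)) θ := by
    have := (intervalIntegral.integral_hasDerivAt_right (hcont.intervalIntegrable 0 (a - θ))
      (hcont.stronglyMeasurableAtFilter _ _) hcont.continuousAt).comp_const_sub a θ
    simpa using this
  have h := ((hF u).sub (hF l)).const_mul (flipSlope ε l u)
  rw [neg_sub_neg] at h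
  refine h.congr_of_eventuallyEq (Eventually.of_forall fun θ' => ?_)
  simp only [derivPsi, Pi.sub_apply]
  rw [intervalIntegral.integral_interval_sub_left (hcont.intervalIntegrable _ _)
    (hcont.intervalIntegrable _ _)]

lemma isBddLip_derivPsi₂ (hα0 : 0 < α) (hα1 : α < 1) (hσ : 0 < σ) :
    IsBddLip (derivPsi₂ α σ ε l u) :=
  (IsBddLip.const _).mul (((isBddLip_aldPDF hα0 hα1 hσ).comp_const_sub l).sub
    ((isBddLip_aldPDF hα0 hα1 hσ).comp_const_sub u))

lemma isBddLip_derivPsi (hα0 : 0 < α) (hα1 : α < 1) (hσ : 0 < σ) (hε : 0 < ε) (hlu : l < u) :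
    IsBddLip (derivPsi α σ ε l u) := by
  have hint := (integrable_integral_aldPDF_zero hα0 hα1 hσ)
  refine .of_hasDerivAt (K := flipSlope ε l u) (fun θ => ?_) (hasDerivAt_derivPsi hα0 hα1 hσ)
    (isBddLip_derivPsi₂ hα0 hα1 hσ)
  rw [abs_of_pos (derivPsi_pos hα0 hα1 hσ hε hlu θ), derivPsi,
    intervalIntegral.integral_of_le (by linarith)]
  refine mul_le_of_le_one_right (flipSlope_pos hε hlu).le ?_
  rw [← hint.2]
  exact setIntegral_le_integral hint.1 (ae_of_all _ fun y => (aldPDF_pos hα0 hα1 hσ 0 y).le)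

end Response

/-! ### The law of an observation -/

section Law

variable {d : ℕ} {α σ ε l u : ℝ}

lemma isMarkovKernel_mechanism (hε : 0 < ε) (hlu : l < u) : IsMarkovKernel (mechanism ε l u) := by
  refine ⟨fun y => ⟨?_⟩⟩
  have h := bitFlip_trunc_mem hε hlu y
  have hC : (flipConst ε)⁻¹ < 1 := inv_lt_one_of_one_lt₀ (one_lt_flipConst hε)
  rw [mechanism_apply, withDensity_apply _ MeasurableSet.univ, Measure.restrict_univ,
    lintegral_count, tsum_fintype, Fintype.sum_bool, bitFlip_false,
    ← ENNReal.ofReal_add (by linarith [h.1]) (by linarith [h.2]), add_sub_cancel,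
    ENNReal.ofReal_one]

/-- Conditional law of the bit `Z` given the covariates, the response being integrated out. -/
noncomputable def bitKernel (α σ ε l u : ℝ) (β : EuclideanSpace ℝ (Fin d)) :
    Kernel (EuclideanSpace ℝ (Fin d)) Bool :=
  (((aldKernel α σ).comap (fun x => inner ℝ β x) (by fun_prop) ⊗ₖ
    (mechanism ε l u).comap Prod.snd measurable_snd)).map Prod.snd

lemma isMarkovKernel_bitKernel (hα0 : 0 < α) (hα1 : α < 1) (hσ : 0 < σ) (hε : 0 < ε) (hlu : l < u)
    (β : EuclideanSpace ℝ (Fin d)) : IsMarkovKernel (bitKernel α σ ε l u β) := by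
  have := isMarkovKernel_aldKernel hα0 hα1 hσ
  have := isMarkovKernel_mechanism hε hlu
  exact Kernel.IsMarkovKernel.map _ measurable_snd

lemma obsLaw_eq_compProd (hα0 : 0 < α) (hα1 : α < 1) (hσ : 0 < σ) (hε : 0 < ε) (hlu : l < u)
    (FX : Measure (EuclideanSpace ℝ (Fin d))) [IsProbabilityMeasure FX]
    (β : EuclideanSpace ℝ (Fin d)) :
    obsLaw α σ ε l u FX β = FX ⊗ₘ bitKernel α σ ε l u β := by
  have := isMarkovKernel_aldKernel hα0 hα1 hσ
  have := isMarkovKernel_mechanism hε hlu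
  rw [bitKernel, Measure.compProd_map measurable_snd]
  rfl

lemma bitKernel_real_true (hα0 : 0 < α) (hα1 : α < 1) (hσ : 0 < σ) (hε : 0 < ε) (hlu : l < u)
    (β x : EuclideanSpace ℝ (Fin d)) :
    (bitKernel α σ ε l u β x).real {true} = Psi α σ ε l u (inner ℝ β x) := by
  have := isMarkovKernel_aldKernel hα0 hα1 hσ
  have := isMarkovKernel_mechanism hε hlu
  have hC : (flipConst ε)⁻¹ < 1 := inv_lt_one_of_one_lt₀ (one_lt_flipConst hε)
  have hnn y : 0 ≤ bitFlip ε l u (trunc l u y) true :=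
    le_trans (by linarith) (bitFlip_trunc_mem hε hlu y).1
  rw [Measure.real, bitKernel, Kernel.map_apply' _ measurable_snd _ (measurableSet_singleton _),
    Kernel.compProd_apply (measurable_snd (measurableSet_singleton _)), Kernel.comap_apply, Psi,
    integral_eq_lintegral_of_nonneg_ae (ae_of_all _ hnn)
      continuous_bitFlip_trunc.aestronglyMeasurable]
  congr 1
  refine lintegral_congr fun y => ?_
  rw [Kernel.comap_apply, mechanism_apply]
  have : Prod.mk y ⁻¹' (Prod.snd ⁻¹' {true}) = ({true} : Set Bool) := by ext; simp
  rw [this, withDensity_apply _ (measurableSet_singleton _), Measure.restrict_singleton]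
  simp

lemma integral_bitKernel (hα0 : 0 < α) (hα1 : α < 1) (hσ : 0 < σ) (hε : 0 < ε) (hlu : l < u)
    (β x : EuclideanSpace ℝ (Fin d)) {F : Type*} [NormedAddCommGroup F] [NormedSpace ℝ F]
    [CompleteSpace F] (f : Bool → F) :
    ∫ z, f z ∂bitKernel α σ ε l u β x =
      Psi α σ ε l u (inner ℝ β x) • f true + (1 - Psi α σ ε l u (inner ℝ β x)) • f false := by
  have := isMarkovKernel_bitKernel hα0 hα1 hσ hε hlu β
  have hc : ({false} : Set Bool) = {true}ᶜ := by ext z; cases z <;> simp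
  rw [integral_fintype .of_finite, Fintype.sum_bool, hc,
    probReal_compl_eq_one_sub (measurableSet_singleton _), bitKernel_real_true hα0 hα1 hσ hε hlu]

lemma integral_obsLaw (hα0 : 0 < α) (hα1 : α < 1) (hσ : 0 < σ) (hε : 0 < ε) (hlu : l < u)
    (FX : Measure (EuclideanSpace ℝ (Fin d))) [IsProbabilityMeasure FX]
    (β : EuclideanSpace ℝ (Fin d)) {F : Type*} [NormedAddCommGroup F] [NormedSpace ℝ F]
    [CompleteSpace F] {f : EuclideanSpace ℝ (Fin d) × Bool → F}
    (hf : Integrable f (obsLaw α σ ε l u FX β)) :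
    ∫ w, f w ∂obsLaw α σ ε l u FX β =
      ∫ x, (Psi α σ ε l u (inner ℝ β x) • f (x, true) +
        (1 - Psi α σ ε l u (inner ℝ β x)) • f (x, false)) ∂FX := by
  have := isMarkovKernel_bitKernel hα0 hα1 hσ hε hlu β
  rw [obsLaw_eq_compProd hα0 hα1 hσ hε hlu] at hf ⊢
  rw [Measure.integral_compProd hf]
  exact integral_congr_ae (ae_of_all _ fun x =>
    integral_bitKernel hα0 hα1 hσ hε hlu β x fun z => f (x, z))

lemma map_fst_obsLaw (hα0 : 0 < α) (hα1 : α < 1) (hσ : 0 < σ) (hε : 0 < ε) (hlu : l < u)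
    (FX : Measure (EuclideanSpace ℝ (Fin d))) [IsProbabilityMeasure FX]
    (β : EuclideanSpace ℝ (Fin d)) : (obsLaw α σ ε l u FX β).map Prod.fst = FX := by
  have := isMarkovKernel_bitKernel hα0 hα1 hσ hε hlu β
  rw [obsLaw_eq_compProd hα0 hα1 hσ hε hlu]
  exact Measure.fst_compProd FX _

lemma isProbabilityMeasure_obsLaw (hα0 : 0 < α) (hα1 : α < 1) (hσ : 0 < σ) (hε : 0 < ε)
    (hlu : l < u) (FX : Measure (EuclideanSpace ℝ (Fin d))) [IsProbabilityMeasure FX]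
    (β : EuclideanSpace ℝ (Fin d)) : IsProbabilityMeasure (obsLaw α σ ε l u FX β) := by
  have := isMarkovKernel_bitKernel hα0 hα1 hσ hε hlu β
  rw [obsLaw_eq_compProd hα0 hα1 hσ hε hlu]
  infer_instance

lemma integrable_comp_fst_obsLaw (hα0 : 0 < α) (hα1 : α < 1) (hσ : 0 < σ) (hε : 0 < ε)
    (hlu : l < u) {FX : Measure (EuclideanSpace ℝ (Fin d))} [IsProbabilityMeasure FX]
    (β : EuclideanSpace ℝ (Fin d)) {f : EuclideanSpace ℝ (Fin d) → ℝ} (hf : Integrable f FX) :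
    Integrable (fun w => f w.1) (obsLaw α σ ε l u FX β) := by
  rw [← map_fst_obsLaw hα0 hα1 hσ hε hlu FX β] at hf
  exact hf.comp_measurable measurable_fst

end Law

/-! ### Log-likelihood of one bit, score and curvature -/

/-- Log-probability of the bit `z` at the linear predictor `θ`. -/
noncomputable def bitLog (α σ ε l u : ℝ) (z : Bool) (θ : ℝ) : ℝ :=
  if z then Real.log (Psi α σ ε l u θ) else Real.log (1 - Psi α σ ε l u θ)

/-- Derivative of `bitLog` in the linear predictor. -/
noncomputable def bitScore (α σ ε l u : ℝ) (z : Bool) (θ : ℝ) : ℝ :=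
  if z then derivPsi α σ ε l u θ / Psi α σ ε l u θ
  else -(derivPsi α σ ε l u θ / (1 - Psi α σ ε l u θ))

/-- Second derivative of `bitLog` in the linear predictor. -/
noncomputable def bitHess (α σ ε l u : ℝ) (z : Bool) (θ : ℝ) : ℝ :=
  if z then derivPsi₂ α σ ε l u θ / Psi α σ ε l u θ -
      derivPsi α σ ε l u θ / Psi α σ ε l u θ * (derivPsi α σ ε l u θ / Psi α σ ε l u θ)
  else -(derivPsi₂ α σ ε l u θ / (1 - Psi α σ ε l u θ)) -
      derivPsi α σ ε l u θ / (1 - Psi α σ ε l u θ) *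
        (derivPsi α σ ε l u θ / (1 - Psi α σ ε l u θ))

/-- Fisher information of one bit about the linear predictor `θ`. -/
noncomputable def bitFisher (α σ ε l u θ : ℝ) : ℝ :=
  derivPsi α σ ε l u θ ^ 2 / (Psi α σ ε l u θ * (1 - Psi α σ ε l u θ))

section Score

variable {α σ ε l u : ℝ}

lemma exists_Psi_bounds (hα0 : 0 < α) (hα1 : α < 1) (hσ : 0 < σ) (hε : 0 < ε) (hlu : l < u) :
    ∃ c > 0, ∀ θ, c ≤ Psi α σ ε l u θ ∧ c ≤ 1 - Psi α σ ε l u θ := by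
  have := isMarkovKernel_aldKernel hα0 hα1 hσ
  have hC : (flipConst ε)⁻¹ < 1 := inv_lt_one_of_one_lt₀ (one_lt_flipConst hε)
  refine ⟨(1 - (flipConst ε)⁻¹) / 2, by linarith, fun θ => ?_⟩
  have h := Psi_mem (α := α) (σ := σ) hε hlu θ
  exact ⟨h.1, by linarith [h.2]⟩

lemma Psi_pos (hα0 : 0 < α) (hα1 : α < 1) (hσ : 0 < σ) (hε : 0 < ε) (hlu : l < u) (θ : ℝ) :
    0 < Psi α σ ε l u θ := by
  obtain ⟨c, hc, h⟩ := exists_Psi_bounds hα0 hα1 hσ hε hlu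
  exact hc.trans_le (h θ).1

lemma one_sub_Psi_pos (hα0 : 0 < α) (hα1 : α < 1) (hσ : 0 < σ) (hε : 0 < ε) (hlu : l < u) (θ : ℝ) :
    0 < 1 - Psi α σ ε l u θ := by
  obtain ⟨c, hc, h⟩ := exists_Psi_bounds hα0 hα1 hσ hε hlu
  exact hc.trans_le (h θ).2

lemma isBddLip_Psi (hα0 : 0 < α) (hα1 : α < 1) (hσ : 0 < σ) (hε : 0 < ε) (hlu : l < u) :
    IsBddLip (Psi α σ ε l u) :=
  .of_hasDerivAt (K := 1) (fun θ => by
    have h0 := Psi_pos hα0 hα1 hσ hε hlu θ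
    have h1 := one_sub_Psi_pos hα0 hα1 hσ hε hlu θ
    rw [abs_of_pos h0]; linarith)
    (hasDerivAt_Psi hα0 hα1 hσ hε hlu) (isBddLip_derivPsi hα0 hα1 hσ hε hlu)

lemma hasDerivAt_bitLog (hα0 : 0 < α) (hα1 : α < 1) (hσ : 0 < σ) (hε : 0 < ε) (hlu : l < u)
    (z : Bool) (θ : ℝ) :
    HasDerivAt (bitLog α σ ε l u z) (bitScore α σ ε l u z θ) θ := by
  have h := hasDerivAt_Psi hα0 hα1 hσ hε hlu θ
  cases z
  · simpa [bitLog, bitScore, neg_div] using! (h.const_sub 1).log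
      (one_sub_Psi_pos hα0 hα1 hσ hε hlu θ).ne'
  · simpa [bitLog, bitScore] using! h.log (Psi_pos hα0 hα1 hσ hε hlu θ).ne'

lemma hasDerivAt_bitScore (hα0 : 0 < α) (hα1 : α < 1) (hσ : 0 < σ) (hε : 0 < ε) (hlu : l < u)
    (z : Bool) (θ : ℝ) :
    HasDerivAt (bitScore α σ ε l u z) (bitHess α σ ε l u z θ) θ := by
  have h := hasDerivAt_Psi hα0 hα1 hσ hε hlu θ
  have h' := hasDerivAt_derivPsi (ε := ε) (l := l) (u := u) hα0 hα1 hσ θ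
  have h0 := (Psi_pos hα0 hα1 hσ hε hlu θ).ne'
  have h1 := (one_sub_Psi_pos hα0 hα1 hσ hε hlu θ).ne'
  cases z
  · have := (h'.div (h.const_sub 1) h1).neg
    simp only [bitHess, Bool.false_eq_true, if_false]
    convert! this using 1
    field_simp
    ring
  · have := h'.div h h0
    simp only [bitHess, if_true]
    convert! this using 1
    field_simp

lemma isBddLip_bitScore (hα0 : 0 < α) (hα1 : α < 1) (hσ : 0 < σ) (hε : 0 < ε) (hlu : l < u)
    (z : Bool) : IsBddLip (bitScore α σ ε l u z) := by
  obtain ⟨c, hc, h⟩ := exists_Psi_bounds hα0 hα1 hσ hε hlu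
  have hP := isBddLip_Psi hα0 hα1 hσ hε hlu
  have hP' := isBddLip_derivPsi hα0 hα1 hσ hε hlu
  cases z
  · exact (hP'.div ((IsBddLip.const 1).sub hP) hc fun θ => (h θ).2).neg
  · exact hP'.div hP hc fun θ => (h θ).1

lemma isBddLip_bitHess (hα0 : 0 < α) (hα1 : α < 1) (hσ : 0 < σ) (hε : 0 < ε) (hlu : l < u)
    (z : Bool) : IsBddLip (bitHess α σ ε l u z) := by
  obtain ⟨c, hc, h⟩ := exists_Psi_bounds hα0 hα1 hσ hε hlu
  have hP := isBddLip_Psi hα0 hα1 hσ hε hlu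
  have hP' := isBddLip_derivPsi hα0 hα1 hσ hε hlu
  have hP'' := isBddLip_derivPsi₂ (ε := ε) (l := l) (u := u) hα0 hα1 hσ
  cases z
  · have hQ := (IsBddLip.const 1).sub hP
    have hs := hP'.div hQ hc fun θ => (h θ).2
    exact (hP''.div hQ hc fun θ => (h θ).2).neg.sub (hs.mul hs)
  · have hs := hP'.div hP hc fun θ => (h θ).1
    exact (hP''.div hP hc fun θ => (h θ).1).sub (hs.mul hs)

lemma isBddLip_bitLog (hα0 : 0 < α) (hα1 : α < 1) (hσ : 0 < σ) (hε : 0 < ε) (hlu : l < u)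
    (z : Bool) : IsBddLip (bitLog α σ ε l u z) := by
  obtain ⟨c, hc, h⟩ := exists_Psi_bounds hα0 hα1 hσ hε hlu
  refine .of_hasDerivAt (K := -Real.log c) (fun θ => ?_)
    (hasDerivAt_bitLog hα0 hα1 hσ hε hlu z) (isBddLip_bitScore hα0 hα1 hσ hε hlu z)
  have key : ∀ p : ℝ, c ≤ p → p ≤ 1 → |Real.log p| ≤ -Real.log c := fun p hp hp1 => by
    rw [abs_of_nonpos (Real.log_nonpos (hc.le.trans hp) hp1), neg_le_neg_iff]
    exact Real.log_le_log hc hp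
  have h0 := (h θ).1
  have h1 := (h θ).2
  cases z
  · exact key _ h1 (by linarith)
  · exact key _ h0 (by linarith)

/-- The score has conditional mean zero. -/
lemma mean_bitScore (hα0 : 0 < α) (hα1 : α < 1) (hσ : 0 < σ) (hε : 0 < ε) (hlu : l < u) (θ : ℝ) :
    Psi α σ ε l u θ * bitScore α σ ε l u true θ +
      (1 - Psi α σ ε l u θ) * bitScore α σ ε l u false θ = 0 := by
  have h0 := (Psi_pos hα0 hα1 hσ hε hlu θ).ne'
  have h1 := (one_sub_Psi_pos hα0 hα1 hσ hε hlu θ).ne'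
  simp only [bitScore, if_true, Bool.false_eq_true, if_false]
  field_simp
  ring

/-- The conditional variance of the score is the Fisher information of the bit. -/
lemma mean_bitScore_sq (hα0 : 0 < α) (hα1 : α < 1) (hσ : 0 < σ) (hε : 0 < ε) (hlu : l < u)
    (θ : ℝ) :
    Psi α σ ε l u θ * bitScore α σ ε l u true θ ^ 2 +
      (1 - Psi α σ ε l u θ) * bitScore α σ ε l u false θ ^ 2 = bitFisher α σ ε l u θ := by
  have h0 := (Psi_pos hα0 hα1 hσ hε hlu θ).ne'
  have h1 := (one_sub_Psi_pos hα0 hα1 hσ hε hlu θ).ne'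
  simp only [bitScore, bitFisher, if_true, Bool.false_eq_true, if_false]
  field_simp
  ring

/-- Information equality: the conditional mean of the second derivative of the log-likelihood is
minus the Fisher information of the bit. -/
lemma mean_bitHess (hα0 : 0 < α) (hα1 : α < 1) (hσ : 0 < σ) (hε : 0 < ε) (hlu : l < u) (θ : ℝ) :
    Psi α σ ε l u θ * bitHess α σ ε l u true θ +
      (1 - Psi α σ ε l u θ) * bitHess α σ ε l u false θ = -bitFisher α σ ε l u θ := by
  have h0 := (Psi_pos hα0 hα1 hσ hε hlu θ).ne'
  have h1 := (one_sub_Psi_pos hα0 hα1 hσ hε hlu θ).ne'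
  simp only [bitHess, bitFisher, if_true, Bool.false_eq_true, if_false]
  field_simp
  ring

lemma bitFisher_pos (hα0 : 0 < α) (hα1 : α < 1) (hσ : 0 < σ) (hε : 0 < ε) (hlu : l < u) (θ : ℝ) :
    0 < bitFisher α σ ε l u θ :=
  div_pos (pow_pos (derivPsi_pos hα0 hα1 hσ hε hlu θ) 2)
    (mul_pos (Psi_pos hα0 hα1 hσ hε hlu θ) (one_sub_Psi_pos hα0 hα1 hσ hε hlu θ))

lemma isBddLip_bitFisher (hα0 : 0 < α) (hα1 : α < 1) (hσ : 0 < σ) (hε : 0 < ε) (hlu : l < u) :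
    IsBddLip (bitFisher α σ ε l u) := by
  obtain ⟨c, hc, h⟩ := exists_Psi_bounds hα0 hα1 hσ hε hlu
  have hP := isBddLip_Psi hα0 hα1 hσ hε hlu
  have hP' := isBddLip_derivPsi hα0 hα1 hσ hε hlu
  unfold bitFisher
  simp only [pow_two]
  exact (hP'.mul hP').div (hP.mul ((IsBddLip.const 1).sub hP)) (mul_pos hc hc) fun θ =>
    mul_le_mul (h θ).1 (h θ).2 hc.le (hc.le.trans (h θ).1)

end Score

/-! ### Expected log-likelihood and Fisher information -/

section Fisher

variable {d : ℕ} {α σ ε l u : ℝ} {FX : Measure (EuclideanSpace ℝ (Fin d))}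

lemma logDensity_eq (fX : EuclideanSpace ℝ (Fin d) → ℝ) (β x : EuclideanSpace ℝ (Fin d))
    (z : Bool) :
    logDensity α σ ε l u fX β x z = bitLog α σ ε l u z (inner ℝ β x) + Real.log (fX x) := rfl

lemma measurable_comp_predictor {G : Bool → ℝ → ℝ} (hG : ∀ z, Continuous (G z))
    (β : EuclideanSpace ℝ (Fin d)) :
    Measurable fun w : EuclideanSpace ℝ (Fin d) × Bool => G w.2 (inner ℝ β w.1) :=
  measurable_from_prod_countable_left fun z =>
    (hG z).measurable.comp
      (by fun_prop : Measurable fun x : EuclideanSpace ℝ (Fin d) => inner ℝ β x)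

lemma integrable_logDensity (hα0 : 0 < α) (hα1 : α < 1) (hσ : 0 < σ) (hε : 0 < ε) (hlu : l < u)
    [IsProbabilityMeasure FX] {fX : EuclideanSpace ℝ (Fin d) → ℝ}
    (hentropy : Integrable (fun x => Real.log (fX x)) FX) (βs β : EuclideanSpace ℝ (Fin d)) :
    Integrable (fun w => logDensity α σ ε l u fX β w.1 w.2) (obsLaw α σ ε l u FX βs) := by
  have := isProbabilityMeasure_obsLaw hα0 hα1 hσ hε hlu FX βs
  have hb := isBddLip_bitLog hα0 hα1 hσ hε hlu
  simp_rw [logDensity_eq]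
  refine Integrable.add ?_ (integrable_comp_fst_obsLaw hα0 hα1 hσ hε hlu βs hentropy)
  obtain ⟨K, hK, -⟩ := hb true
  obtain ⟨L, hL, -⟩ := hb false
  refine Integrable.of_bound (C := max K L)
    (measurable_comp_predictor (fun z => (hb z).continuous) β).aestronglyMeasurable
    (ae_of_all _ fun w => ?_)
  rcases w with ⟨x, _ | _⟩
  · exact (hL _).trans (le_max_right _ _)
  · exact (hK _).trans (le_max_left _ _)

/-- Gibbs' inequality for two Bernoulli laws. -/
lemma mul_log_add_mul_log_le {p q : ℝ} (hp : 0 < p) (hp1 : 0 < 1 - p) (hq : 0 < q)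
    (hq1 : 0 < 1 - q) :
    p * Real.log q + (1 - p) * Real.log (1 - q) ≤
      p * Real.log p + (1 - p) * Real.log (1 - p) := by
  have key : ∀ a b : ℝ, 0 < a → 0 < b → a * Real.log b - a * Real.log a ≤ b - a := by
    intro a b ha hb
    have := Real.log_le_sub_one_of_pos (div_pos hb ha)
    rw [Real.log_div hb.ne' ha.ne'] at this
    calc _ = a * (Real.log b - Real.log a) := by ring
      _ ≤ a * (b / a - 1) := by gcongr
      _ = b - a := by field_simp
  have h1 := key p q hp hq
  have h2 := key (1 - p) (1 - q) hp1 hq1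
  linarith

/-- The expected log-likelihood of a correctly specified model is maximal at the true
parameter. -/
lemma expLogLik_le (hα0 : 0 < α) (hα1 : α < 1) (hσ : 0 < σ) (hε : 0 < ε) (hlu : l < u)
    [IsProbabilityMeasure FX] {fX : EuclideanSpace ℝ (Fin d) → ℝ}
    (hentropy : Integrable (fun x => Real.log (fX x)) FX) (βs β : EuclideanSpace ℝ (Fin d)) :
    expLogLik α σ ε l u fX (obsLaw α σ ε l u FX βs) β ≤
      expLogLik α σ ε l u fX (obsLaw α σ ε l u FX βs) βs := by
  have := isMarkovKernel_bitKernel hα0 hα1 hσ hε hlu βs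
  have hint := integrable_logDensity hα0 hα1 hσ hε hlu hentropy βs
  have hcond (β : EuclideanSpace ℝ (Fin d)) : Integrable (fun x =>
      Psi α σ ε l u (inner ℝ βs x) • logDensity α σ ε l u fX β x true +
        (1 - Psi α σ ε l u (inner ℝ βs x)) • logDensity α σ ε l u fX β x false) FX := by
    have h := hint β
    rw [obsLaw_eq_compProd hα0 hα1 hσ hε hlu] at h
    refine (Integrable.integral_compProd (κ := Kernel.const Unit FX)
      (η := Kernel.prodMkLeft Unit (bitKernel α σ ε l u βs)) (a := ()) h).congr
      (ae_of_all _ fun x => ?_)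
    exact integral_bitKernel hα0 hα1 hσ hε hlu βs x fun z => logDensity α σ ε l u fX β x z
  rw [expLogLik, expLogLik, integral_obsLaw hα0 hα1 hσ hε hlu FX βs (hint β),
    integral_obsLaw hα0 hα1 hσ hε hlu FX βs (hint βs)]
  refine integral_mono (hcond β) (hcond βs) fun x => ?_
  have h := mul_log_add_mul_log_le (Psi_pos hα0 hα1 hσ hε hlu (inner ℝ βs x))
    (one_sub_Psi_pos hα0 hα1 hσ hε hlu (inner ℝ βs x))
    (Psi_pos hα0 hα1 hσ hε hlu (inner ℝ β x)) (one_sub_Psi_pos hα0 hα1 hσ hε hlu (inner ℝ β x))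
  simp only [logDensity_eq, bitLog, smul_eq_mul, if_true, Bool.false_eq_true, if_false]
  linarith

lemma fisherIntegrand_eq (hα0 : 0 < α) (hα1 : α < 1) (hσ : 0 < σ) (hε : 0 < ε) (hlu : l < u)
    (β : EuclideanSpace ℝ (Fin d)) (j k : Fin d) (x : EuclideanSpace ℝ (Fin d)) :
    fisherIntegrand α σ ε l u β j k x =
      bitFisher α σ ε l u (inner ℝ β x) * (x j * x k) := by
  rw [fisherIntegrand, (hasDerivAt_Psi hα0 hα1 hσ hε hlu _).deriv, bitFisher]

lemma abs_mul_coord_le (x : EuclideanSpace ℝ (Fin d)) (j k : Fin d) : |x j * x k| ≤ ‖x‖ ^ 2 := by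
  rw [abs_mul, pow_two]
  exact mul_le_mul (PiLp.norm_apply_le x j) (PiLp.norm_apply_le x k) (abs_nonneg _)
    (norm_nonneg _)

lemma integrable_fisherIntegrand (hα0 : 0 < α) (hα1 : α < 1) (hσ : 0 < σ) (hε : 0 < ε)
    (hlu : l < u) (hmoment : Integrable (fun x => ‖x‖ ^ 2) FX)
    (β : EuclideanSpace ℝ (Fin d)) (j k : Fin d) :
    Integrable (fisherIntegrand α σ ε l u β j k) FX := by
  have hb := isBddLip_bitFisher hα0 hα1 hσ hε hlu
  obtain ⟨K, hK, -⟩ := id hb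
  refine (hmoment.const_mul K).mono' ?_ (ae_of_all _ fun x => ?_)
  · rw [funext (fisherIntegrand_eq hα0 hα1 hσ hε hlu β j k)]
    have := hb.continuous
    exact (by fun_prop : Continuous fun x : EuclideanSpace ℝ (Fin d) =>
      bitFisher α σ ε l u (inner ℝ β x) * (x j * x k)).aestronglyMeasurable
  · rw [fisherIntegrand_eq hα0 hα1 hσ hε hlu, norm_mul]
    exact mul_le_mul (hK _) (abs_mul_coord_le x j k) (norm_nonneg _)
      ((abs_nonneg _).trans (hK 0))

lemma dotProduct_fisherInfo_mulVec (hα0 : 0 < α) (hα1 : α < 1) (hσ : 0 < σ) (hε : 0 < ε)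
    (hlu : l < u) (hmoment : Integrable (fun x => ‖x‖ ^ 2) FX)
    (β v w : EuclideanSpace ℝ (Fin d)) :
    v.ofLp ⬝ᵥ (fisherInfo α σ ε l u FX β).mulVec w.ofLp =
      ∫ x, bitFisher α σ ε l u (inner ℝ β x) * (inner ℝ x v * inner ℝ x w) ∂FX := by
  have hi j k := (integrable_fisherIntegrand hα0 hα1 hσ hε hlu hmoment β j k)
  have e (x : EuclideanSpace ℝ (Fin d)) :
      bitFisher α σ ε l u (inner ℝ β x) * (inner ℝ x v * inner ℝ x w) =
        ∑ j, ∑ k, v j * (fisherIntegrand α σ ε l u β j k x * w k) := by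
    simp_rw [fisherIntegrand_eq hα0 hα1 hσ hε hlu, PiLp.inner_apply, Finset.sum_mul_sum,
      Finset.mul_sum]
    refine Finset.sum_congr rfl fun j _ => Finset.sum_congr rfl fun k _ => ?_
    simp
    ring
  simp_rw [e]
  rw [integral_finsetSum _ fun j _ => integrable_finsetSum _ fun k _ =>
    ((hi j k).mul_const _).const_mul _]
  refine Finset.sum_congr rfl fun j _ => ?_
  rw [integral_finsetSum _ fun k _ => ((hi j k).mul_const _).const_mul _, Matrix.mulVec,
    dotProduct, Finset.mul_sum]
  refine Finset.sum_congr rfl fun k _ => ?_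
  rw [integral_const_mul, integral_mul_const]
  rfl

/-- The Fisher information is positive definite when the expected log-likelihood has a unique
maximizer: along a direction in its kernel almost every linear predictor is constant, so moving
the interior point `βs` along that direction gives further maximizers. -/
lemma posDef_fisherInfo (hα0 : 0 < α) (hα1 : α < 1) (hσ : 0 < σ) (hε : 0 < ε) (hlu : l < u)
    [IsProbabilityMeasure FX] {fX : EuclideanSpace ℝ (Fin d) → ℝ}
    (hentropy : Integrable (fun x => Real.log (fX x)) FX)
    (hmoment : Integrable (fun x => ‖x‖ ^ 2) FX)
    {B : Set (EuclideanSpace ℝ (Fin d))} {βs : EuclideanSpace ℝ (Fin d)} (hβs : βs ∈ interior B)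
    (hunique : ∃! β, β ∈ B ∧ IsMaxOn (expLogLik α σ ε l u fX (obsLaw α σ ε l u FX βs)) B β) :
    (fisherInfo α σ ε l u FX βs).PosDef := by
  have hpos := bitFisher_pos hα0 hα1 hσ hε hlu
  have hb := isBddLip_bitFisher hα0 hα1 hσ hε hlu
  have hquad := dotProduct_fisherInfo_mulVec hα0 hα1 hσ hε hlu hmoment βs
  refine .of_dotProduct_mulVec_pos ?_ fun v hv => ?_
  · ext j k
    simp [fisherInfo, fisherIntegrand, mul_comm]
  · set v' : EuclideanSpace ℝ (Fin d) := WithLp.toLp 2 v with hv'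
    have hv0 : v' ≠ 0 := fun h => hv (by simpa [hv'] using h)
    have hq := hquad v' v'
    simp only [star_trivial]
    change 0 < v'.ofLp ⬝ᵥ (fisherInfo α σ ε l u FX βs).mulVec v'.ofLp
    have hnn : 0 ≤ fun x => bitFisher α σ ε l u (inner ℝ βs x) * (inner ℝ x v' * inner ℝ x v') :=
      fun x => mul_nonneg (hpos _).le (mul_self_nonneg _)
    rw [hq]
    refine lt_of_le_of_ne (integral_nonneg hnn) fun h0 => hv0 ?_
    have hint : Integrable (fun x =>
        bitFisher α σ ε l u (inner ℝ βs x) * (inner ℝ x v' * inner ℝ x v')) FX := by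
      obtain ⟨K, hK, -⟩ := id hb
      have := hb.continuous
      refine (hmoment.const_mul (K * ‖v'‖ ^ 2)).mono'
        (by fun_prop : Continuous fun x : EuclideanSpace ℝ (Fin d) =>
          bitFisher α σ ε l u (inner ℝ βs x) *
            (inner ℝ x v' * inner ℝ x v')).aestronglyMeasurable
        (ae_of_all _ fun x => ?_)
      have h1 := abs_real_inner_le_norm x v'
      rw [norm_mul, norm_mul, Real.norm_eq_abs, Real.norm_eq_abs]
      calc _ ≤ K * ((‖x‖ * ‖v'‖) * (‖x‖ * ‖v'‖)) := by
            have := (abs_nonneg _).trans (hK 0)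
            gcongr
            exact hK _
        _ = _ := by ring
    have hae : ∀ᵐ x ∂FX, inner ℝ x v' = 0 := by
      filter_upwards [(integral_eq_zero_iff_of_nonneg hnn hint).1 h0.symm] with x hx
      simpa [(hpos _).ne'] using hx
    have hmax (t : ℝ) : expLogLik α σ ε l u fX (obsLaw α σ ε l u FX βs) (βs + t • v') =
        expLogLik α σ ε l u fX (obsLaw α σ ε l u FX βs) βs := by
      have hae' : ∀ᵐ w ∂obsLaw α σ ε l u FX βs, inner ℝ w.1 v' = 0 := by
        rw [← map_fst_obsLaw hα0 hα1 hσ hε hlu FX βs] at hae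
        exact ae_of_ae_map measurable_fst.aemeasurable hae
      refine integral_congr_ae ?_
      filter_upwards [hae'] with w hw
      simp only [logDensity_eq, inner_add_left, real_inner_smul_left, real_inner_comm w.1 v', hw,
        mul_zero, add_zero]
    have hnhds : ∀ᶠ t : ℝ in 𝓝[≠] 0, βs + t • v' ∈ B := by
      have hc : Tendsto (fun t : ℝ => βs + t • v') (𝓝[≠] 0) (𝓝 βs) := by
        have : Continuous fun t : ℝ => βs + t • v' := by fun_prop
        simpa using (this.tendsto 0).mono_left nhdsWithin_le_nhds
      exact hc (mem_interior_iff_mem_nhds.1 hβs)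
    obtain ⟨t, htB, ht0⟩ := (hnhds.and self_mem_nhdsWithin).exists
    have e := hunique.unique
      ⟨interior_subset hβs, fun β _ => expLogLik_le hα0 hα1 hσ hε hlu hentropy βs β⟩
      ⟨htB, fun β _ => by
        simpa only [Set.mem_ofPred_eq, hmax t] using
          expLogLik_le hα0 hα1 hσ hε hlu hentropy βs β⟩
    have : t • v' = 0 := by simpa using e
    exact (smul_eq_zero.1 this).resolve_left ht0

end Fisher

/-! ### Convergence in distribution of random vectors -/

section Distribution

variable {E Ω Ω' : Type*} [MeasurableSpace Ω] {μ : Measure Ω} [NormedAddCommGroup E]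
  [MeasurableSpace E] [BorelSpace E]

lemma charFun_map_eq_charFun_map_inner [InnerProductSpace ℝ E] [SecondCountableTopology E]
    {W : Ω → E} (hW : AEMeasurable W μ) (t : E) :
    charFun (μ.map W) t = charFun (μ.map fun ω => inner ℝ (W ω) t) 1 := by
  have hc : Continuous fun x : E => Complex.exp (inner ℝ x t * Complex.I) := by fun_prop
  rw [charFun_apply, charFun_apply, integral_map hW hc.aestronglyMeasurable,
    integral_map (by fun_prop) (by fun_prop)]
  simp

variable [IsProbabilityMeasure μ] [MeasurableSpace Ω'] {μ' : Measure Ω'} [IsProbabilityMeasure μ']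

/-- **Cramér–Wold device**. -/
lemma tendstoInDistribution_of_inner [InnerProductSpace ℝ E] [FiniteDimensional ℝ E]
    {W : ℕ → Ω → E} {Z : Ω' → E}
    (hW : ∀ n, AEMeasurable (W n) μ) (hZ : AEMeasurable Z μ')
    (h : ∀ t, TendstoInDistribution (fun n ω => inner ℝ (W n ω) t) atTop
      (fun ω => inner ℝ (Z ω) t) (fun _ => μ) μ') :
    TendstoInDistribution W atTop Z (fun _ => μ) μ' where
  forall_aemeasurable := hW
  aemeasurable_limit := hZ
  tendsto := by
    refine ProbabilityMeasure.tendsto_iff_tendsto_charFun.2 fun t => ?_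
    have := ProbabilityMeasure.tendsto_iff_tendsto_charFun.1 (h t).tendsto 1
    simp only [ProbabilityMeasure.coe_mk] at this ⊢
    rw [charFun_map_eq_charFun_map_inner hZ]
    simpa only [charFun_map_eq_charFun_map_inner (hW _)] using this

/-- **Multivariate central limit theorem** for centred square integrable vectors; the covariance
is prescribed through its quadratic form. -/
lemma tendstoInDistribution_inv_sqrt_smul_sum {d : ℕ} {ξ : ℕ → Ω → EuclideanSpace ℝ (Fin d)}
    (hindep : iIndepFun ξ μ) (hident : ∀ i, IdentDistrib (ξ i) (ξ 0) μ μ)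
    (hL2 : ∀ t, MemLp (fun ω => inner ℝ (ξ 0 ω) t) 2 μ) (hmean : ∀ t, ∫ ω, inner ℝ (ξ 0 ω) t ∂μ = 0)
    {S : Matrix (Fin d) (Fin d) ℝ} (hS : S.PosSemidef)
    (hvar : ∀ t : EuclideanSpace ℝ (Fin d),
      ∫ ω, (inner ℝ (ξ 0 ω) t) ^ 2 ∂μ = t.ofLp ⬝ᵥ S.mulVec t.ofLp) :
    TendstoInDistribution (fun (n : ℕ) ω => (√n)⁻¹ • ∑ i ∈ Finset.range n, ξ i ω) atTop id
      (fun _ => μ) (multivariateGaussian 0 S) := by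
  have hm i := (hident i).aemeasurable_fst
  refine tendstoInDistribution_of_inner (fun n =>
    (Finset.aemeasurable_fun_sum _ fun i _ => hm i).fun_const_smul _) aemeasurable_id fun t => ?_
  have hVar : Var[fun ω => inner ℝ (ξ 0 ω) t; μ] = t.ofLp ⬝ᵥ S.mulVec t.ofLp := by
    rw [variance_eq_sub (hL2 t), hmean, ← hvar]
    simp
  have hlaw : HasLaw (fun x : EuclideanSpace ℝ (Fin d) => inner ℝ x t)
      (gaussianReal 0 Var[fun ω => inner ℝ (ξ 0 ω) t; μ].toNNReal)
      (multivariateGaussian 0 S) := by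
    refine ⟨by fun_prop, ?_⟩
    have h := IsGaussian.map_eq_gaussianReal (μ := multivariateGaussian 0 S) (innerSL ℝ t)
    have e : (fun x : EuclideanSpace ℝ (Fin d) => inner ℝ x t) = innerSL ℝ t := by
      ext x; simp [real_inner_comm]
    have hv : Var[innerSL ℝ t; multivariateGaussian 0 S] = t.ofLp ⬝ᵥ S.mulVec t.ofLp := by
      rw [← covarianceBilin_multivariateGaussian (μ := 0) hS, covarianceBilin_self
        IsGaussian.memLp_two_id]
      rfl
    rw [e, h, hVar, hv, ContinuousLinearMap.integral_comp_id_comm IsGaussian.integrable_id]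
    simp
  have key := tendstoInDistribution_inv_sqrt_mul_sum_sub (P := μ)
    (X := fun i ω => inner ℝ (ξ i ω) t) hlaw (hL2 t)
    (hindep.comp (fun _ x => inner ℝ x t) fun _ => by fun_prop)
    (fun i => (hident i).comp (u := fun x => inner ℝ x t) (by fun_prop))
  simpa [real_inner_smul_left, sum_inner, hmean] using key

/-- Slutsky's theorem for a relative error that vanishes almost surely. -/
lemma tendstoInDistribution_of_norm_sub_le [SecondCountableTopology E] {W T : ℕ → Ω → E}
    {Z : Ω' → E} {η : ℕ → Ω → ℝ} (hWZ : TendstoInDistribution W atTop Z (fun _ => μ) μ')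
    (hT : ∀ n, AEMeasurable (T n) μ) (hη : ∀ n, AEMeasurable (η n) μ)
    (hη0 : ∀ᵐ ω ∂μ, Tendsto (fun n => η n ω) atTop (𝓝 0))
    (hTW : ∀ᵐ ω ∂μ, ∀ᶠ n in atTop, ‖T n ω - W n ω‖ ≤ η n ω * ‖W n ω‖) :
    TendstoInDistribution T atTop Z (fun _ => μ) μ' := by
  have hW := hWZ.forall_aemeasurable
  refine tendstoInDistribution_of_tendstoInMeasure_sub T Z hWZ ?_ hT
  have h1 := hWZ.continuous_comp_prodMk_of_tendstoInMeasure_const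
    (g := fun p : E × ℝ => p.2 * ‖p.1‖) (by fun_prop)
    (tendstoInMeasure_of_tendsto_ae (fun n => (hη n).aestronglyMeasurable) hη0) hη
  -- The error splits into `η n * ‖W n‖`, small in probability, and a part that almost surely
  -- vanishes eventually.
  have h2 : TendstoInMeasure μ
      (fun n ω => max 0 (‖T n ω - W n ω‖ - η n ω * ‖W n ω‖)) atTop fun _ => (0 : ℝ) := by
    refine tendstoInMeasure_of_tendsto_ae (fun n => AEMeasurable.aestronglyMeasurable ?_) ?_
    · have := hT n; have := hW n; have := hη n; fun_prop
    · filter_upwards [hTW] with ω hω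
      refine tendsto_const_nhds.congr' ?_
      filter_upwards [hω] with n hn
      rw [max_eq_left (by linarith)]
  rw [tendstoInMeasure_iff_norm] at h2 ⊢
  intro δ hδ
  have h3 := h2 (δ / 2) (by positivity)
  have h4 : Tendsto (fun n => μ {ω | δ / 2 ≤ η n ω * ‖W n ω‖}) atTop (𝓝 0) := by
    have hcl := ProbabilityMeasure.limsup_measure_closed_le_of_tendsto h1.tendsto
      (isClosed_Ici (a := δ / 2))
    simp only [ProbabilityMeasure.coe_mk] at hcl
    have e (n : ℕ) : μ.map (fun ω => η n ω * ‖W n ω‖) (Set.Ici (δ / 2)) =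
        μ {ω | δ / 2 ≤ η n ω * ‖W n ω‖} := by
      have := hW n
      rw [Measure.map_apply_of_aemeasurable ((hη n).fun_mul (hW n).norm) measurableSet_Ici]
      rfl
    have e' : μ'.map (fun ω => (0 : ℝ) * ‖Z ω‖) (Set.Ici (δ / 2)) = 0 := by
      simp [hδ]
    simp_rw [e, e'] at hcl
    exact tendsto_of_le_liminf_of_limsup_le zero_le hcl
  refine tendsto_of_tendsto_of_tendsto_of_le_of_le tendsto_const_nhds
    (by simpa using h3.add h4) (fun _ => zero_le) fun n => ?_
  refine (measure_mono fun ω hω => ?_).trans (measure_union_le _ _)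
  simp only [Set.mem_union, Set.mem_ofPred_eq, Pi.sub_apply, Pi.zero_apply, sub_zero] at hω ⊢
  by_contra! hcon
  have h5 := (le_max_right 0 (‖T n ω - W n ω‖ - η n ω * ‖W n ω‖)).trans (le_abs_self _)
  linarith [hcon.1, hcon.2]

end Distribution

/-! ### Averages of functions of independent observations -/

/-- Strong law of large numbers for a function of independent observations with law `P`. -/
lemma strong_law_comp {Ω 𝓧 F : Type*} [MeasurableSpace Ω] {μ : Measure Ω} [MeasurableSpace 𝓧]
    {P : Measure 𝓧} {V : ℕ → Ω → 𝓧} (hindep : iIndepFun V μ) (hlaw : ∀ i, HasLaw (V i) P μ)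
    [NormedAddCommGroup F] [NormedSpace ℝ F] [CompleteSpace F] [MeasurableSpace F] [BorelSpace F]
    {f : 𝓧 → F} (hf : Measurable f) (hfi : Integrable f P) :
    ∀ᵐ ω ∂μ, Tendsto (fun n : ℕ => (n : ℝ)⁻¹ • ∑ i ∈ Finset.range n, f (V i ω)) atTop
      (𝓝 (∫ v, f v ∂P)) := by
  have hi : Integrable (fun ω => f (V 0 ω)) μ := by
    rw [← (hlaw 0).map_eq] at hfi
    exact hfi.comp_aemeasurable (hlaw 0).aemeasurable
  have hident i : IdentDistrib (V i) (V 0) μ μ :=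
    ⟨(hlaw i).aemeasurable, (hlaw 0).aemeasurable, (hlaw i).map_eq.trans (hlaw 0).map_eq.symm⟩
  have h := strong_law_ae (fun i ω => f (V i ω)) hi
    (fun i j hij => (hindep.indepFun hij).comp hf hf) fun i => (hident i).comp hf
  rwa [show ∫ v, f v ∂P = ∫ ω, f (V 0 ω) ∂μ by
    rw [← (hlaw 0).map_eq, integral_map (hlaw 0).aemeasurable]
    rw [(hlaw 0).map_eq]; exact hfi.aestronglyMeasurable]

/-- Consistency of maximizers, for one realization: if the functions `M n` are uniformly
Lipschitz on the compact set `B` and converge pointwise on a dense subset to a continuous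
function with a unique maximizer, then their maximizers converge to it. -/
lemma tendsto_of_isMaxOn {E : Type*} [PseudoMetricSpace E] {B D : Set E} (hB : IsCompact B)
    (hD : D ⊆ B) (hBD : B ⊆ closure D) {M : ℕ → E → ℝ} {m : E → ℝ} (hm : ContinuousOn m B) {L : ℝ}
    (hL0 : 0 ≤ L) (hL : ∀ᶠ n in atTop, ∀ x ∈ B, ∀ y ∈ B, M n x - M n y ≤ L * dist x y)
    (hlim : ∀ x ∈ D, Tendsto (fun n => M n x) atTop (𝓝 (m x)))
    {b : ℕ → E} (hb : ∀ n, b n ∈ B) (hmax : ∀ n, IsMaxOn (M n) B (b n)) {x₀ : E}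
    (hx₀ : ∀ x ∈ B, IsMaxOn m B x → x = x₀) : Tendsto b atTop (𝓝 x₀) := by
  refine hB.tendsto_nhds_of_unique_mapClusterPt (Eventually.of_forall hb) fun x hx hcl =>
    hx₀ x hx ?_
  -- A cluster point `x` of the maximizers maximizes the limit `m`.
  have key : ∀ y ∈ D, ∀ y' ∈ D, m y ≤ m y' + L * dist x y' := by
    intro y hy y' hy'
    refine le_of_forall_pos_le_add fun δ hδ => ?_
    have hδ' : 0 < δ / (L + 2) := by positivity
    have e1 := (hlim y hy).eventually_const_lt (sub_lt_self _ hδ')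
    have e2 := (hlim y' hy').eventually_lt_const (lt_add_of_pos_right _ hδ')
    have hfr : ∃ᶠ n in atTop, b n ∈ Metric.ball x (δ / (L + 2)) :=
      hcl.frequently (Metric.ball_mem_nhds x hδ')
    obtain ⟨n, hn, hn1, hn2, hnL⟩ := (hfr.and_eventually (e1.and (e2.and hL))).exists
    have h1 : M n y ≤ M n (b n) := hmax n (hD hy)
    have h2 := hnL (b n) (hb n) y' (hD hy')
    have h3 : dist (b n) y' ≤ δ / (L + 2) + dist x y' :=
      (dist_triangle _ x _).trans (add_le_add_left (Metric.mem_ball.1 hn).le _)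
    have h4 : L * dist (b n) y' ≤ L * (δ / (L + 2) + dist x y') := by gcongr
    have h5 : (L + 2) * (δ / (L + 2)) = δ := by field_simp
    linarith
  have key2 : ∀ y ∈ D, m y ≤ m x := by
    intro y hy
    have hne : (𝓝[D] x).NeBot := mem_closure_iff_nhdsWithin_neBot.1 (hBD hx)
    have hdist : Tendsto (fun y' => dist x y') (𝓝[D] x) (𝓝 0) := by
      simpa using ((continuous_const.dist continuous_id :
        Continuous fun y' => dist x y').tendsto x).mono_left (nhdsWithin_le_nhds (s := D))
    have hlim' : Tendsto (fun y' => m y' + L * dist x y') (𝓝[D] x) (𝓝 (m x + L * 0)) :=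
      ((hm x hx).mono_left (nhdsWithin_mono x hD)).add (hdist.const_mul L)
    rw [mul_zero, add_zero] at hlim'
    exact ge_of_tendsto hlim' (eventually_mem_nhdsWithin.mono fun y' hy' => key y hy y' hy')
  intro y hy
  have hne : (𝓝[D] y).NeBot := mem_closure_iff_nhdsWithin_neBot.1 (hBD hy)
  exact le_of_tendsto ((hm y hy).mono_left (nhdsWithin_mono y hD))
    (eventually_mem_nhdsWithin.mono key2)

/-! ### Consistency -/

section Consistency

variable {d : ℕ} {α σ ε l u : ℝ} {FX : Measure (EuclideanSpace ℝ (Fin d))}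

lemma exists_isBddLip_const {G : Bool → ℝ → ℝ} (hG : ∀ z, IsBddLip (G z)) :
    ∃ K, 0 ≤ K ∧ (∀ z x, |G z x| ≤ K) ∧ ∀ z x y, |G z x - G z y| ≤ K * |x - y| := by
  obtain ⟨K, hK, hK'⟩ := hG true
  obtain ⟨L, hL, hL'⟩ := hG false
  refine ⟨max K L, le_max_of_le_left ((abs_nonneg _).trans (hK 0)), ?_, ?_⟩
  · rintro (_ | _) x
    exacts [(hL x).trans (le_max_right _ _), (hK x).trans (le_max_left _ _)]
  · rintro (_ | _) x y
    exacts [(hL' x y).trans (by gcongr; exact le_max_right _ _),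
      (hK' x y).trans (by gcongr; exact le_max_left _ _)]

lemma continuous_expLogLik (hα0 : 0 < α) (hα1 : α < 1) (hσ : 0 < σ) (hε : 0 < ε) (hlu : l < u)
    [IsProbabilityMeasure FX] {fX : EuclideanSpace ℝ (Fin d) → ℝ}
    (hentropy : Integrable (fun x => Real.log (fX x)) FX) (βs : EuclideanSpace ℝ (Fin d)) :
    Continuous (expLogLik α σ ε l u fX (obsLaw α σ ε l u FX βs)) := by
  have := isProbabilityMeasure_obsLaw hα0 hα1 hσ hε hlu FX βs
  have hb := isBddLip_bitLog hα0 hα1 hσ hε hlu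
  obtain ⟨K, -, hK, -⟩ := exists_isBddLip_const hb
  refine continuous_of_dominated (bound := fun w => K + |Real.log (fX w.1)|)
    (fun β => (integrable_logDensity hα0 hα1 hσ hε hlu hentropy βs β).aestronglyMeasurable)
    (fun β => ae_of_all _ fun w => ?_)
    ((integrable_const _).add (integrable_comp_fst_obsLaw hα0 hα1 hσ hε hlu βs hentropy.abs))
    (ae_of_all _ fun w => ?_)
  · exact (abs_add_le _ _).trans (add_le_add_left (hK _ _) _)
  · have := (hb w.2).continuous
    simp_rw [logDensity_eq]
    fun_prop

lemma logLik_sub_le {K : ℝ} (hK : ∀ z x y,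
      |bitLog α σ ε l u z x - bitLog α σ ε l u z y| ≤ K * |x - y|) (hK0 : 0 ≤ K)
    (fX : EuclideanSpace ℝ (Fin d) → ℝ) (n : ℕ) (x : ℕ → EuclideanSpace ℝ (Fin d)) (z : ℕ → Bool)
    (β β' : EuclideanSpace ℝ (Fin d)) :
    logLik α σ ε l u fX n x z β - logLik α σ ε l u fX n x z β' ≤
      K * ((n : ℝ)⁻¹ • ∑ i ∈ Finset.range n, ‖x i‖) * dist β β' := by
  rw [logLik, logLik, ← mul_sub, ← Finset.sum_sub_distrib, one_div, smul_eq_mul]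
  calc _ ≤ (n : ℝ)⁻¹ * ∑ i ∈ Finset.range n, K * (‖x i‖ * dist β β') := by
        gcongr with i
        rw [logDensity_eq, logDensity_eq, add_sub_add_right_eq_sub]
        refine (le_abs_self _).trans ((hK _ _ _).trans ?_)
        rw [← inner_sub_left, dist_eq_norm, mul_comm ‖x i‖]
        gcongr
        exact abs_real_inner_le_norm _ _
    _ = _ := by rw [← Finset.mul_sum, ← Finset.sum_mul]; ring

lemma integrable_norm_of_sq [IsProbabilityMeasure FX]
    (hmoment : Integrable (fun x => ‖x‖ ^ 2) FX) : Integrable (fun x => ‖x‖) FX := by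
  refine ((integrable_const 1).add hmoment).mono' (by fun_prop) (ae_of_all _ fun x => ?_)
  rw [norm_norm, Pi.add_apply]
  nlinarith [sq_nonneg (‖x‖ - 1)]

/-- Strong consistency of the maximum likelihood estimator. -/
lemma tendsto_mle (hα0 : 0 < α) (hα1 : α < 1) (hσ : 0 < σ) (hε : 0 < ε) (hlu : l < u)
    [IsProbabilityMeasure FX] {fX : EuclideanSpace ℝ (Fin d) → ℝ} (hfX_meas : Measurable fX)
    (hentropy : Integrable (fun x => Real.log (fX x)) FX)
    (hmoment : Integrable (fun x => ‖x‖ ^ 2) FX)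
    {B : Set (EuclideanSpace ℝ (Fin d))} (hB : IsCompact B) {βs : EuclideanSpace ℝ (Fin d)}
    (hβs : βs ∈ B)
    (hunique : ∃! β, β ∈ B ∧ IsMaxOn (expLogLik α σ ε l u fX (obsLaw α σ ε l u FX βs)) B β)
    {Ω : Type*} [MeasurableSpace Ω] {μ : Measure Ω}
    {X : ℕ → Ω → EuclideanSpace ℝ (Fin d)} {Z : ℕ → Ω → Bool}
    (hindep : iIndepFun (fun i ω => (X i ω, Z i ω)) μ)
    (hlaw : ∀ i, HasLaw (fun ω => (X i ω, Z i ω)) (obsLaw α σ ε l u FX βs) μ)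
    {βhat : ℕ → Ω → EuclideanSpace ℝ (Fin d)}
    (hβhat : ∀ n, ∀ᵐ ω ∂μ, βhat n ω ∈ B ∧
      IsMaxOn (logLik α σ ε l u fX n (fun i => X i ω) (fun i => Z i ω)) B (βhat n ω)) :
    ∀ᵐ ω ∂μ, Tendsto (fun n => βhat n ω) atTop (𝓝 βs) := by
  have hb := isBddLip_bitLog hα0 hα1 hσ hε hlu
  obtain ⟨K, hK0, -, hK⟩ := exists_isBddLip_const hb
  obtain ⟨D, hDB, hDc, hBD⟩ := hB.isSeparable.exists_countable_dense_subset
  have h1 := strong_law_comp hindep hlaw measurable_fst.norm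
    (integrable_comp_fst_obsLaw hα0 hα1 hσ hε hlu βs (integrable_norm_of_sq hmoment))
  have h2 : ∀ᵐ ω ∂μ, ∀ β ∈ D, Tendsto (fun n : ℕ => (n : ℝ)⁻¹ • ∑ i ∈ Finset.range n,
      logDensity α σ ε l u fX β (X i ω) (Z i ω)) atTop
      (𝓝 (expLogLik α σ ε l u fX (obsLaw α σ ε l u FX βs) β)) := by
    refine (ae_ball_iff hDc).2 fun β _ => ?_
    refine strong_law_comp hindep hlaw (f := fun w => logDensity α σ ε l u fX β w.1 w.2) ?_
      (integrable_logDensity hα0 hα1 hσ hε hlu hentropy βs β)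
    exact (measurable_comp_predictor (fun z => (hb z).continuous) β).add
      (Real.measurable_log.comp (hfX_meas.comp measurable_fst))
  filter_upwards [h1, h2, ae_all_iff.2 hβhat] with ω hω1 hω2 hω3
  have hA0 : 0 ≤ ∫ w, ‖w.1‖ ∂obsLaw α σ ε l u FX βs := integral_nonneg fun w => norm_nonneg _
  refine tendsto_of_isMaxOn hB hDB hBD
    (continuous_expLogLik hα0 hα1 hσ hε hlu hentropy βs).continuousOn
    (L := K * (∫ w, ‖w.1‖ ∂obsLaw α σ ε l u FX βs + 1))
    (M := fun n => logLik α σ ε l u fX n (fun i => X i ω) (fun i => Z i ω))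
    (by positivity) ?_ ?_ (fun n => (hω3 n).1) (fun n => (hω3 n).2) ?_
  · filter_upwards [hω1.eventually_lt_const (lt_add_one _)] with n hn β _ β' _
    refine (logLik_sub_le hK hK0 fX n _ _ β β').trans ?_
    gcongr
  · intro β hβ
    simpa only [logLik, one_div, smul_eq_mul] using hω2 β hβ
  · intro β hβ hmax
    exact hunique.unique ⟨hβ, hmax⟩
      ⟨hβs, fun β _ => expLogLik_le hα0 hα1 hσ hε hlu hentropy βs β⟩

end Consistency

/-! ### Linearization of the likelihood equation -/

section Linearization

variable {d : ℕ} {α σ ε l u : ℝ}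

/-- First-order Taylor bound when the derivative is bounded and Lipschitz. The factor
`min 2 |b - a|` keeps the remainder integrable under a second moment only. -/
lemma abs_taylor_remainder_le {f f' : ℝ → ℝ} {K : ℝ} (hf : ∀ x, HasDerivAt f (f' x) x)
    (hK0 : 0 ≤ K) (hK : ∀ x, |f' x| ≤ K) (hL : ∀ x y, |f' x - f' y| ≤ K * |x - y|) (a b : ℝ) :
    |f b - f a - f' a * (b - a)| ≤ K * min 2 |b - a| * |b - a| := by
  -- The mean value inequality for `x ↦ f x - f' a * x`, whose derivative is small between `a`
  -- and `b`.
  have key := Convex.norm_image_sub_le_of_norm_hasDerivWithin_le (s := Set.uIcc a b)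
    (f := fun x => f x - f' a * x) (f' := fun x => f' x - f' a * 1) (C := K * min 2 |b - a|)
    (fun x _ => ((hf x).sub ((hasDerivAt_id x).const_mul (f' a))).hasDerivWithinAt) (fun x hx => ?_)
    (convex_uIcc a b) Set.left_mem_uIcc Set.right_mem_uIcc
  · rw [Real.norm_eq_abs, Real.norm_eq_abs] at key
    convert key using 2
    ring
  · rw [mul_one, Real.norm_eq_abs, mul_min_of_nonneg _ _ hK0]
    refine le_min ?_ ((hL x a).trans ?_)
    · exact (abs_sub _ _).trans (by linarith [hK x, hK a])
    · exact mul_le_mul_of_nonneg_left (Set.abs_sub_left_of_mem_uIcc hx) hK0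

/-- The likelihood equation at an interior maximizer. -/
lemma sum_bitScore_smul_eq_zero (hα0 : 0 < α) (hα1 : α < 1) (hσ : 0 < σ) (hε : 0 < ε)
    (hlu : l < u) {fX : EuclideanSpace ℝ (Fin d) → ℝ} {n : ℕ} (hn : n ≠ 0)
    {x : ℕ → EuclideanSpace ℝ (Fin d)} {z : ℕ → Bool}
    {B : Set (EuclideanSpace ℝ (Fin d))} {b : EuclideanSpace ℝ (Fin d)} (hb : b ∈ interior B)
    (hmax : IsMaxOn (logLik α σ ε l u fX n x z) B b) :
    ∑ i ∈ Finset.range n, bitScore α σ ε l u (z i) (inner ℝ b (x i)) • x i = 0 := by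
  -- The directional derivative of the log-likelihood along the total score `v` is `‖v‖² / n`.
  set v := ∑ i ∈ Finset.range n, bitScore α σ ε l u (z i) (inner ℝ b (x i)) • x i with hv
  have hloc : IsLocalMax (fun t : ℝ => logLik α σ ε l u fX n x z (b + t • v)) 0 := by
    have hc : Tendsto (fun t : ℝ => b + t • v) (𝓝 0) (𝓝 b) := by
      have : Continuous fun t : ℝ => b + t • v := by fun_prop
      simpa using this.tendsto 0
    filter_upwards [hc (mem_interior_iff_mem_nhds.1 hb)] with t ht
    simpa using hmax ht
  have hderiv : HasDerivAt (fun t : ℝ => logLik α σ ε l u fX n x z (b + t • v))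
      (1 / (n : ℝ) * ∑ i ∈ Finset.range n,
        bitScore α σ ε l u (z i) (inner ℝ b (x i)) * inner ℝ v (x i)) 0 := by
    unfold logLik
    refine (HasDerivAt.fun_sum fun i _ => ?_).const_mul _
    simp_rw [logDensity_eq, inner_add_left, real_inner_smul_left]
    refine HasDerivAt.add_const _ ?_
    have h1 : HasDerivAt (fun t : ℝ => inner ℝ b (x i) + t * inner ℝ v (x i))
        (inner ℝ v (x i)) 0 := by
      simpa using ((hasDerivAt_id (0 : ℝ)).mul_const (inner ℝ v (x i))).const_add
        (inner ℝ b (x i))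
    have h2 := hasDerivAt_bitLog hα0 hα1 hσ hε hlu (z i) (inner ℝ b (x i) + 0 * inner ℝ v (x i))
    simpa using! h2.comp (0 : ℝ) h1
  have h0 := hloc.hasDerivAt_eq_zero hderiv
  have h1 : inner ℝ v v = ∑ i ∈ Finset.range n,
      bitScore α σ ε l u (z i) (inner ℝ b (x i)) * inner ℝ v (x i) := by
    conv_lhs => rw [hv, inner_sum]
    simp_rw [inner_smul_right]
    rfl
  rw [← h1] at h0
  simpa [hn] using h0

/-- The rank-one operator `v ↦ ⟪x, v⟫ x`. -/
noncomputable def outer (x : EuclideanSpace ℝ (Fin d)) :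
    EuclideanSpace ℝ (Fin d) →L[ℝ] EuclideanSpace ℝ (Fin d) :=
  (innerSL ℝ x).smulRight x

@[simp]
lemma outer_apply (x v : EuclideanSpace ℝ (Fin d)) : outer x v = inner ℝ x v • x := by
  simp [outer]

lemma norm_outer (x : EuclideanSpace ℝ (Fin d)) : ‖outer x‖ = ‖x‖ ^ 2 := by
  rw [outer, ContinuousLinearMap.norm_smulRight_apply, innerSL_apply_norm, pow_two]

lemma continuous_outer : Continuous (outer : EuclideanSpace ℝ (Fin d) → _) :=
  ((ContinuousLinearMap.smulRightL ℝ (EuclideanSpace ℝ (Fin d))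
    (EuclideanSpace ℝ (Fin d))).continuous.comp (innerSL ℝ).continuous).clm_apply continuous_id

/-- Hessian of the average log-likelihood of `n` observations at the parameter `β`. -/
noncomputable def averageHess (α σ ε l u : ℝ) (n : ℕ) (x : ℕ → EuclideanSpace ℝ (Fin d))
    (z : ℕ → Bool) (β : EuclideanSpace ℝ (Fin d)) :
    EuclideanSpace ℝ (Fin d) →L[ℝ] EuclideanSpace ℝ (Fin d) :=
  (n : ℝ)⁻¹ • ∑ i ∈ Finset.range n, bitHess α σ ε l u (z i) (inner ℝ β (x i)) • outer (x i)

/-- Bound for the relative error of the linearized average score, at a parameter at distance `δ`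
from the point of linearization; `K` bounds `bitHess` and its Lipschitz constant. -/
noncomputable def averageRemainder (K : ℝ) (n : ℕ) (x : ℕ → EuclideanSpace ℝ (Fin d)) (δ : ℝ) :
    ℝ :=
  (n : ℝ)⁻¹ * ∑ i ∈ Finset.range n, K * min 2 (δ * ‖x i‖) * ‖x i‖ ^ 2

lemma averageRemainder_nonneg {K : ℝ} (hK0 : 0 ≤ K) (n : ℕ) (x : ℕ → EuclideanSpace ℝ (Fin d))
    {δ : ℝ} (hδ : 0 ≤ δ) : 0 ≤ averageRemainder K n x δ := by
  unfold averageRemainder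
  positivity

/-- Linearization of the likelihood equation at the true parameter `βs`. -/
lemma norm_score_add_hess_le (hα0 : 0 < α) (hα1 : α < 1) (hσ : 0 < σ) (hε : 0 < ε) (hlu : l < u)
    {K : ℝ} (hK0 : 0 ≤ K) (hK : ∀ z x, |bitHess α σ ε l u z x| ≤ K)
    (hL : ∀ z x y, |bitHess α σ ε l u z x - bitHess α σ ε l u z y| ≤ K * |x - y|)
    {n : ℕ} {x : ℕ → EuclideanSpace ℝ (Fin d)} {z : ℕ → Bool} {b βs : EuclideanSpace ℝ (Fin d)}
    (hb : ∑ i ∈ Finset.range n, bitScore α σ ε l u (z i) (inner ℝ b (x i)) • x i = 0) :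
    ‖(n : ℝ)⁻¹ • ∑ i ∈ Finset.range n, bitScore α σ ε l u (z i) (inner ℝ βs (x i)) • x i +
      averageHess α σ ε l u n x z βs (b - βs)‖ ≤ averageRemainder K n x ‖b - βs‖ * ‖b - βs‖ := by
  unfold averageHess averageRemainder
  have e : (n : ℝ)⁻¹ • ∑ i ∈ Finset.range n, bitScore α σ ε l u (z i) (inner ℝ βs (x i)) • x i +
      ((n : ℝ)⁻¹ • ∑ i ∈ Finset.range n,
        bitHess α σ ε l u (z i) (inner ℝ βs (x i)) • outer (x i)) (b - βs) =
      (n : ℝ)⁻¹ • ∑ i ∈ Finset.range n, (-(bitScore α σ ε l u (z i) (inner ℝ b (x i)) -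
        bitScore α σ ε l u (z i) (inner ℝ βs (x i)) -
        bitHess α σ ε l u (z i) (inner ℝ βs (x i)) *
          (inner ℝ b (x i) - inner ℝ βs (x i)))) • x i := by
    rw [← sub_zero (Finset.sum _ _), ← hb]
    simp only [smul_apply, sum_apply, outer_apply, ← smul_add,
      ← Finset.sum_add_distrib, ← Finset.sum_sub_distrib]
    congr 1
    refine Finset.sum_congr rfl fun i _ => ?_
    rw [← inner_sub_left, real_inner_comm (b - βs) (x i)]
    module
  rw [e, norm_smul, mul_assoc, Finset.sum_mul]
  rw [Real.norm_of_nonneg (by positivity)]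
  gcongr
  refine (norm_sum_le _ _).trans (Finset.sum_le_sum fun i _ => ?_)
  rw [norm_smul, norm_neg, Real.norm_eq_abs]
  have h := abs_taylor_remainder_le (hasDerivAt_bitScore hα0 hα1 hσ hε hlu (z i)) hK0 (hK (z i))
    (hL (z i)) (inner ℝ βs (x i)) (inner ℝ b (x i))
  have hin : |inner ℝ b (x i) - inner ℝ βs (x i)| ≤ ‖b - βs‖ * ‖x i‖ := by
    rw [← inner_sub_left]; exact abs_real_inner_le_norm _ _
  calc _ ≤ (K * min 2 (‖b - βs‖ * ‖x i‖) * (‖b - βs‖ * ‖x i‖)) * ‖x i‖ := by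
        gcongr
        refine h.trans ?_
        gcongr
    _ = _ := by ring

/-- Solving a linearized equation `G + H v ≈ 0` whose operator `H` is close to `-F`, where `J` is
a left inverse of `F`. -/
lemma norm_sub_le_of_linearized {E : Type*} [NormedAddCommGroup E] [NormedSpace ℝ E]
    {F J H : E →L[ℝ] E} (hJ : J * F = 1) {G v : E} {ρ : ℝ} (hρ : 0 ≤ ρ)
    (h : ‖G + H v‖ ≤ ρ * ‖v‖)
    (hη : ‖J‖ * (‖H + F‖ + ρ) ≤ 1 / 2) :
    ‖v - J G‖ ≤ 2 * (‖J‖ * (‖H + F‖ + ρ)) * ‖J G‖ := by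
  have e : v - J G = J ((H + F) v - (G + H v)) := by
    have : J (F v) = v := by
      rw [← mul_apply_eq_comp, hJ, one_apply_eq_self]
    simp only [add_apply, map_sub, map_add, this]
    abel
  have h1 : ‖v - J G‖ ≤ ‖J‖ * (‖H + F‖ + ρ) * ‖v‖ := by
    rw [e, mul_assoc]
    refine (J.le_opNorm _).trans ?_
    gcongr
    rw [add_mul]
    exact (norm_sub_le _ _).trans (add_le_add ((H + F).le_opNorm v) h)
  have h2 : ‖v‖ ≤ ‖v - J G‖ + ‖J G‖ := by simpa using norm_add_le (v - J G) (J G)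
  have h3 := norm_nonneg (v - J G)
  have h4 := norm_nonneg (J G)
  have hη0 : 0 ≤ ‖J‖ * (‖H + F‖ + ρ) := by positivity
  nlinarith [mul_le_mul_of_nonneg_left h2 hη0]

end Linearization

/-! ### Asymptotic normality -/

section Normality

variable {d : ℕ} {α σ ε l u : ℝ} {FX : Measure (EuclideanSpace ℝ (Fin d))}

lemma inner_toEuclideanCLM_fisherInfo (hα0 : 0 < α) (hα1 : α < 1) (hσ : 0 < σ) (hε : 0 < ε)
    (hlu : l < u) (hmoment : Integrable (fun x => ‖x‖ ^ 2) FX)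
    (β v w : EuclideanSpace ℝ (Fin d)) :
    inner ℝ v (Matrix.toEuclideanCLM (𝕜 := ℝ) (fisherInfo α σ ε l u FX β) w) =
      ∫ x, bitFisher α σ ε l u (inner ℝ β x) * (inner ℝ x v * inner ℝ x w) ∂FX := by
  rw [Matrix.inner_toEuclideanCLM, dotProduct_fisherInfo_mulVec hα0 hα1 hσ hε hlu hmoment]

lemma measurable_hess_smul_outer (hα0 : 0 < α) (hα1 : α < 1) (hσ : 0 < σ) (hε : 0 < ε)
    (hlu : l < u) (βs : EuclideanSpace ℝ (Fin d)) :
    Measurable fun w : EuclideanSpace ℝ (Fin d) × Bool =>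
      bitHess α σ ε l u w.2 (inner ℝ βs w.1) • outer w.1 :=
  (measurable_comp_predictor (fun z => (isBddLip_bitHess hα0 hα1 hσ hε hlu z).continuous) βs).smul
    (continuous_outer.measurable.comp measurable_fst)

lemma integrable_hess_smul_outer (hα0 : 0 < α) (hα1 : α < 1) (hσ : 0 < σ) (hε : 0 < ε)
    (hlu : l < u) [IsProbabilityMeasure FX] (hmoment : Integrable (fun x => ‖x‖ ^ 2) FX)
    (βs : EuclideanSpace ℝ (Fin d)) :
    Integrable (fun w : EuclideanSpace ℝ (Fin d) × Bool =>
      bitHess α σ ε l u w.2 (inner ℝ βs w.1) • outer w.1) (obsLaw α σ ε l u FX βs) := by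
  obtain ⟨K, hK0, hK, -⟩ := exists_isBddLip_const (isBddLip_bitHess hα0 hα1 hσ hε hlu)
  refine (integrable_comp_fst_obsLaw hα0 hα1 hσ hε hlu βs (hmoment.const_mul K)).mono'
    (measurable_hess_smul_outer hα0 hα1 hσ hε hlu βs).aestronglyMeasurable
    (ae_of_all _ fun w => ?_)
  rw [norm_smul, norm_outer]
  gcongr
  exact hK _ _

lemma aestronglyMeasurable_averageHess (hα0 : 0 < α) (hα1 : α < 1) (hσ : 0 < σ) (hε : 0 < ε)
    (hlu : l < u) [IsProbabilityMeasure FX] (hmoment : Integrable (fun x => ‖x‖ ^ 2) FX)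
    {βs : EuclideanSpace ℝ (Fin d)} {Ω : Type*} [MeasurableSpace Ω] {μ : Measure Ω}
    {X : ℕ → Ω → EuclideanSpace ℝ (Fin d)} {Z : ℕ → Ω → Bool}
    (hlaw : ∀ i, HasLaw (fun ω => (X i ω, Z i ω)) (obsLaw α σ ε l u FX βs) μ) (n : ℕ) :
    AEStronglyMeasurable
      (fun ω => averageHess α σ ε l u n (fun i => X i ω) (fun i => Z i ω) βs) μ := by
  unfold averageHess
  have hHi i : AEStronglyMeasurable (fun ω =>
      bitHess α σ ε l u (Z i ω) (inner ℝ βs (X i ω)) • outer (X i ω)) μ := by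
    have h := (integrable_hess_smul_outer hα0 hα1 hσ hε hlu hmoment βs).aestronglyMeasurable
    rw [← (hlaw i).map_eq] at h
    exact h.comp_aemeasurable (hlaw i).aemeasurable
  have hsum := Finset.aestronglyMeasurable_fun_sum (Finset.range n) fun i _ => hHi i
  exact hsum.const_smul (n : ℝ)⁻¹

/-- Information equality: the expected Hessian of the log-likelihood at the true parameter is
minus the Fisher information. -/
lemma integral_hess_smul_outer (hα0 : 0 < α) (hα1 : α < 1) (hσ : 0 < σ) (hε : 0 < ε)
    (hlu : l < u) [IsProbabilityMeasure FX] (hmoment : Integrable (fun x => ‖x‖ ^ 2) FX)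
    (βs : EuclideanSpace ℝ (Fin d)) :
    ∫ w, bitHess α σ ε l u w.2 (inner ℝ βs w.1) • outer w.1 ∂obsLaw α σ ε l u FX βs =
      -Matrix.toEuclideanCLM (𝕜 := ℝ) (fisherInfo α σ ε l u FX βs) := by
  have hint := integrable_hess_smul_outer hα0 hα1 hσ hε hlu hmoment βs
  refine ContinuousLinearMap.ext fun v => ext_inner_left ℝ fun t => ?_
  have hv := hint.apply_continuousLinearMap v
  rw [ContinuousLinearMap.integral_apply hint, neg_apply, inner_neg_right,
    inner_toEuclideanCLM_fisherInfo hα0 hα1 hσ hε hlu hmoment, ← integral_inner hv,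
    integral_obsLaw hα0 hα1 hσ hε hlu FX βs (hv.const_inner t), ← integral_neg]
  refine integral_congr_ae (ae_of_all _ fun x => ?_)
  have h := mean_bitHess hα0 hα1 hσ hε hlu (inner ℝ βs x)
  simp only [smul_apply, outer_apply, inner_smul_right, smul_eq_mul, real_inner_comm x t]
  linear_combination (inner ℝ x v * inner ℝ x t) * h

lemma tendsto_averageHess (hα0 : 0 < α) (hα1 : α < 1) (hσ : 0 < σ) (hε : 0 < ε)
    (hlu : l < u) [IsProbabilityMeasure FX] (hmoment : Integrable (fun x => ‖x‖ ^ 2) FX)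
    {βs : EuclideanSpace ℝ (Fin d)} {Ω : Type*} [MeasurableSpace Ω] {μ : Measure Ω}
    {X : ℕ → Ω → EuclideanSpace ℝ (Fin d)} {Z : ℕ → Ω → Bool}
    (hindep : iIndepFun (fun i ω => (X i ω, Z i ω)) μ)
    (hlaw : ∀ i, HasLaw (fun ω => (X i ω, Z i ω)) (obsLaw α σ ε l u FX βs) μ) :
    ∀ᵐ ω ∂μ, Tendsto (fun n => averageHess α σ ε l u n (fun i => X i ω) (fun i => Z i ω) βs) atTop
      (𝓝 (-Matrix.toEuclideanCLM (𝕜 := ℝ) (fisherInfo α σ ε l u FX βs))) := by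
  rw [← integral_hess_smul_outer hα0 hα1 hσ hε hlu hmoment]
  exact strong_law_comp hindep hlaw (measurable_hess_smul_outer hα0 hα1 hσ hε hlu βs)
    (integrable_hess_smul_outer hα0 hα1 hσ hε hlu hmoment βs)

/-- The averaged remainder of the linearization vanishes along any sequence of parameters that
converges to the true one. -/
lemma tendsto_averageRemainder [IsProbabilityMeasure FX]
    (hmoment : Integrable (fun x => ‖x‖ ^ 2) FX) (K : ℝ) (hK0 : 0 ≤ K)
    {Ω : Type*} [MeasurableSpace Ω] {μ : Measure Ω} {X : ℕ → Ω → EuclideanSpace ℝ (Fin d)}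
    (hindep : iIndepFun X μ) (hlaw : ∀ i, HasLaw (X i) FX μ) {δ : ℕ → Ω → ℝ}
    (hδ0 : ∀ n ω, 0 ≤ δ n ω) (hδ : ∀ᵐ ω ∂μ, Tendsto (fun n => δ n ω) atTop (𝓝 0)) :
    ∀ᵐ ω ∂μ, Tendsto (fun n => averageRemainder K n (fun i => X i ω) (δ n ω)) atTop (𝓝 0) := by
  -- Once `δ n ω < 1 / (k + 1)`, the summands are at most `φ k`, whose mean tends to `0` with `k`.
  set φ : ℕ → EuclideanSpace ℝ (Fin d) → ℝ := fun k x =>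
    K * min 2 (1 / ((k : ℝ) + 1) * ‖x‖) * ‖x‖ ^ 2 with hφ
  have hφc k : Continuous (φ k) := by fun_prop
  have hφb k x : ‖φ k x‖ ≤ K * 2 * ‖x‖ ^ 2 := by
    rw [Real.norm_of_nonneg (by positivity)]
    exact mul_le_mul_of_nonneg_right (mul_le_mul_of_nonneg_left (min_le_left _ _) hK0)
      (by positivity)
  have hφi k : Integrable (φ k) FX :=
    (hmoment.const_mul (K * 2)).mono' (hφc k).aestronglyMeasurable (ae_of_all _ (hφb k))
  have hφ0 : Tendsto (fun k => ∫ x, φ k x ∂FX) atTop (𝓝 0) := by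
    have h := tendsto_integral_of_dominated_convergence (μ := FX) (F := φ) (f := fun _ => 0)
      (fun x => K * 2 * ‖x‖ ^ 2) (fun k => (hφc k).aestronglyMeasurable)
      (hmoment.const_mul (K * 2)) (fun k => ae_of_all _ (hφb k)) (ae_of_all _ fun x => ?_)
    · simpa using h
    · have h1 : Tendsto (fun k : ℕ => 1 / ((k : ℝ) + 1) * ‖x‖) atTop (𝓝 (0 * ‖x‖)) :=
        tendsto_one_div_add_atTop_nhds_zero_nat.mul_const _
      have h2 := (((tendsto_const_nhds (x := (2 : ℝ))).min h1).const_mul K).mul_const (‖x‖ ^ 2)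
      simpa [hφ] using h2
  have hslln := ae_all_iff.2 fun k => strong_law_comp hindep hlaw (hφc k).measurable (hφi k)
  filter_upwards [hslln, hδ] with ω hω hω0
  rw [Metric.tendsto_atTop']
  intro ε hε
  obtain ⟨k, hk⟩ := (hφ0.eventually_lt_const hε).exists
  have h1 := (hω k).eventually_lt_const hk
  have h2 := hω0.eventually_lt_const (show (0 : ℝ) < 1 / ((k : ℝ) + 1) by positivity)
  obtain ⟨N, hN⟩ := eventually_atTop.1 (h1.and h2)
  refine ⟨N, fun n hn => ?_⟩
  obtain ⟨hn1, hn2⟩ := hN n hn.le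
  have := hδ0 n ω
  rw [dist_zero_right, Real.norm_of_nonneg (averageRemainder_nonneg hK0 n _ (hδ0 n ω))]
  refine lt_of_le_of_lt ?_ hn1
  simp only [hφ, smul_eq_mul, averageRemainder]
  gcongr

/-- Central limit theorem for the scores, premultiplied by the inverse Fisher information. -/
lemma tendstoInDistribution_score (hα0 : 0 < α) (hα1 : α < 1) (hσ : 0 < σ) (hε : 0 < ε)
    (hlu : l < u) [IsProbabilityMeasure FX] (hmoment : Integrable (fun x => ‖x‖ ^ 2) FX)
    {βs : EuclideanSpace ℝ (Fin d)} (hpd : (fisherInfo α σ ε l u FX βs).PosDef)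
    {Ω : Type*} [MeasurableSpace Ω] {μ : Measure Ω} [IsProbabilityMeasure μ]
    {X : ℕ → Ω → EuclideanSpace ℝ (Fin d)} {Z : ℕ → Ω → Bool}
    (hindep : iIndepFun (fun i ω => (X i ω, Z i ω)) μ)
    (hlaw : ∀ i, HasLaw (fun ω => (X i ω, Z i ω)) (obsLaw α σ ε l u FX βs) μ) :
    TendstoInDistribution (fun (n : ℕ) ω => (√n)⁻¹ • ∑ i ∈ Finset.range n,
        Matrix.toEuclideanCLM (𝕜 := ℝ) (fisherInfo α σ ε l u FX βs)⁻¹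
          (bitScore α σ ε l u (Z i ω) (inner ℝ βs (X i ω)) • X i ω)) atTop id
      (fun _ => μ) (multivariateGaussian 0 (fisherInfo α σ ε l u FX βs)⁻¹) := by
  set A := fisherInfo α σ ε l u FX βs with hA
  set J := Matrix.toEuclideanCLM (𝕜 := ℝ) A⁻¹ with hJ
  have := isProbabilityMeasure_obsLaw hα0 hα1 hσ hε hlu FX βs
  have hb := isBddLip_bitScore hα0 hα1 hσ hε hlu
  obtain ⟨K, hK0, hK, -⟩ := exists_isBddLip_const hb
  have hsc := measurable_comp_predictor (fun z => (hb z).continuous) βs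
  have hm : Measurable fun w : EuclideanSpace ℝ (Fin d) × Bool =>
      J (bitScore α σ ε l u w.2 (inner ℝ βs w.1) • w.1) :=
    J.continuous.measurable.comp (hsc.smul measurable_fst)
  have hJsymm (x t : EuclideanSpace ℝ (Fin d)) : inner ℝ (J x) t = inner ℝ x (J t) := by
    have hs : A⁻¹.transpose = A⁻¹ := by simpa using hpd.inv.isHermitian.eq
    rw [real_inner_comm, hJ, Matrix.inner_toEuclideanCLM, Matrix.inner_toEuclideanCLM,
      Matrix.dotProduct_mulVec, ← Matrix.mulVec_transpose, hs, dotProduct_comm]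
  have hinner (w : EuclideanSpace ℝ (Fin d) × Bool) (t : EuclideanSpace ℝ (Fin d)) :
      inner ℝ (J (bitScore α σ ε l u w.2 (inner ℝ βs w.1) • w.1)) t =
        bitScore α σ ε l u w.2 (inner ℝ βs w.1) * inner ℝ w.1 (J t) := by
    rw [hJsymm, real_inner_smul_left]
  have hmt (t : EuclideanSpace ℝ (Fin d)) : Measurable fun w : EuclideanSpace ℝ (Fin d) × Bool =>
      bitScore α σ ε l u w.2 (inner ℝ βs w.1) * inner ℝ w.1 (J t) :=
    hsc.mul (measurable_fst.inner_const)
  have hident i : IdentDistrib (fun ω => (X i ω, Z i ω)) (fun ω => (X 0 ω, Z 0 ω)) μ μ :=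
    ⟨(hlaw i).aemeasurable, (hlaw 0).aemeasurable, (hlaw i).map_eq.trans (hlaw 0).map_eq.symm⟩
  have hL2 (t : EuclideanSpace ℝ (Fin d)) :
      MemLp (fun w : EuclideanSpace ℝ (Fin d) × Bool =>
        bitScore α σ ε l u w.2 (inner ℝ βs w.1) * inner ℝ w.1 (J t)) 2
        (obsLaw α σ ε l u FX βs) := by
    rw [memLp_two_iff_integrable_sq (hmt t).aestronglyMeasurable]
    refine (integrable_comp_fst_obsLaw hα0 hα1 hσ hε hlu βs
      (hmoment.const_mul (K ^ 2 * ‖J t‖ ^ 2))).mono'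
      ((hmt t).pow_const 2).aestronglyMeasurable (ae_of_all _ fun w => ?_)
    rw [Real.norm_of_nonneg (sq_nonneg _), ← sq_abs, abs_mul]
    calc _ ≤ (K * (‖w.1‖ * ‖J t‖)) ^ 2 := by
          gcongr
          · exact hK _ _
          · exact abs_real_inner_le_norm _ _
      _ = _ := by ring
  -- Expectations under `μ` of functions of the first observation, as integrals against its law.
  have hexp {f : EuclideanSpace ℝ (Fin d) × Bool → ℝ} (hf : Measurable f) :
      ∫ ω, f (X 0 ω, Z 0 ω) ∂μ = ∫ w, f w ∂obsLaw α σ ε l u FX βs := by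
    rw [← (hlaw 0).map_eq, integral_map (hlaw 0).aemeasurable hf.aestronglyMeasurable]
  refine tendstoInDistribution_inv_sqrt_smul_sum
    (ξ := fun i ω => J (bitScore α σ ε l u (Z i ω) (inner ℝ βs (X i ω)) • X i ω))
    (hindep.comp (fun _ w => J (bitScore α σ ε l u w.2 (inner ℝ βs w.1) • w.1)) fun _ => hm)
    (fun i => (hident i).comp hm) (fun t => ?_) (fun t => ?_) hpd.inv.posSemidef fun t => ?_
  · have h := hL2 t
    rw [← (hlaw 0).map_eq] at h
    exact MemLp.ae_eq (ae_of_all _ fun ω => (hinner (X 0 ω, Z 0 ω) t).symm)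
      (h.comp_of_map (hlaw 0).aemeasurable)
  · rw [integral_congr_ae (ae_of_all _ fun ω => hinner (X 0 ω, Z 0 ω) t), hexp (hmt t),
      integral_obsLaw hα0 hα1 hσ hε hlu FX βs ((hL2 t).integrable one_le_two)]
    refine integral_eq_zero_of_ae (ae_of_all _ fun x => ?_)
    have h := mean_bitScore hα0 hα1 hσ hε hlu (inner ℝ βs x)
    simp only [smul_eq_mul, Pi.zero_apply]
    linear_combination inner ℝ x (J t) * h
  · rw [integral_congr_ae (ae_of_all _ fun ω => congrArg (· ^ 2) (hinner (X 0 ω, Z 0 ω) t)),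
      hexp ((hmt t).pow_const 2),
      integral_obsLaw hα0 hα1 hσ hε hlu FX βs (hL2 t).integrable_sq]
    have hFJ : Matrix.toEuclideanCLM (𝕜 := ℝ) A (J t) = t := by
      rw [← mul_apply_eq_comp, hJ, ← map_mul, Matrix.mul_nonsing_inv _
        ((Matrix.isUnit_iff_isUnit_det _).1 hpd.isUnit), map_one, one_apply_eq_self]
    have hquad : inner ℝ (J t) t = inner ℝ (J t) (Matrix.toEuclideanCLM (𝕜 := ℝ) A (J t)) := by
      rw [hFJ]
    rw [← Matrix.inner_toEuclideanCLM, ← hJ, ← hJsymm, hquad, hA,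
      inner_toEuclideanCLM_fisherInfo hα0 hα1 hσ hε hlu hmoment]
    refine integral_congr_ae (ae_of_all _ fun x => ?_)
    have h := mean_bitScore_sq hα0 hα1 hσ hε hlu (inner ℝ βs x)
    simp only [smul_eq_mul]
    linear_combination inner ℝ x (J t) ^ 2 * h

/-- Relative error of the linearized likelihood equation, for one realization. -/
lemma norm_sqrt_smul_sub_le (hα0 : 0 < α) (hα1 : α < 1) (hσ : 0 < σ) (hε : 0 < ε) (hlu : l < u)
    {K : ℝ} (hK0 : 0 ≤ K) (hK : ∀ z x, |bitHess α σ ε l u z x| ≤ K)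
    (hL : ∀ z x y, |bitHess α σ ε l u z x - bitHess α σ ε l u z y| ≤ K * |x - y|)
    {F J : EuclideanSpace ℝ (Fin d) →L[ℝ] EuclideanSpace ℝ (Fin d)} (hJ : J * F = 1)
    {n : ℕ} {x : ℕ → EuclideanSpace ℝ (Fin d)} {z : ℕ → Bool}
    {b βs : EuclideanSpace ℝ (Fin d)}
    (hb : ∑ i ∈ Finset.range n, bitScore α σ ε l u (z i) (inner ℝ b (x i)) • x i = 0)
    (hη : ‖J‖ * (‖averageHess α σ ε l u n x z βs + F‖ + averageRemainder K n x ‖b - βs‖) ≤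
      1 / 2) :
    ‖√n • (b - βs) - (√n)⁻¹ • ∑ i ∈ Finset.range n,
        J (bitScore α σ ε l u (z i) (inner ℝ βs (x i)) • x i)‖ ≤
      2 * (‖J‖ * (‖averageHess α σ ε l u n x z βs + F‖ + averageRemainder K n x ‖b - βs‖)) *
        ‖(√n)⁻¹ • ∑ i ∈ Finset.range n,
          J (bitScore α σ ε l u (z i) (inner ℝ βs (x i)) • x i)‖ := by
  have hlin := norm_score_add_hess_le hα0 hα1 hσ hε hlu hK0 hK hL (βs := βs) hb
  have key := norm_sub_le_of_linearized hJ (averageRemainder_nonneg hK0 n x (norm_nonneg _))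
    hlin hη
  have hs : √(n : ℝ) * (n : ℝ)⁻¹ = (√n)⁻¹ := by
    rw [← Real.sqrt_div_self, div_eq_mul_inv]
  have e : (√(n : ℝ))⁻¹ • ∑ i ∈ Finset.range n,
      J (bitScore α σ ε l u (z i) (inner ℝ βs (x i)) • x i) =
      √n • J ((n : ℝ)⁻¹ • ∑ i ∈ Finset.range n,
        bitScore α σ ε l u (z i) (inner ℝ βs (x i)) • x i) := by
    rw [map_smul, smul_smul, hs, map_sum]
  rw [e, ← smul_sub, norm_smul, norm_smul, mul_left_comm]
  exact mul_le_mul_of_nonneg_left key (norm_nonneg _)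

/-- A strongly consistent solution sequence of the likelihood equations is asymptotically
normal. -/
lemma tendstoInDistribution_mle (hα0 : 0 < α) (hα1 : α < 1) (hσ : 0 < σ) (hε : 0 < ε)
    (hlu : l < u) [IsProbabilityMeasure FX] (hmoment : Integrable (fun x => ‖x‖ ^ 2) FX)
    {βs : EuclideanSpace ℝ (Fin d)} (hpd : (fisherInfo α σ ε l u FX βs).PosDef)
    {Ω : Type*} [MeasurableSpace Ω] {μ : Measure Ω} [IsProbabilityMeasure μ]
    {X : ℕ → Ω → EuclideanSpace ℝ (Fin d)} {Z : ℕ → Ω → Bool}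
    (hindep : iIndepFun (fun i ω => (X i ω, Z i ω)) μ)
    (hlaw : ∀ i, HasLaw (fun ω => (X i ω, Z i ω)) (obsLaw α σ ε l u FX βs) μ)
    {βhat : ℕ → Ω → EuclideanSpace ℝ (Fin d)} (hmeas : ∀ n, AEMeasurable (βhat n) μ)
    (hcons : ∀ᵐ ω ∂μ, Tendsto (fun n => βhat n ω) atTop (𝓝 βs))
    (hscore : ∀ᵐ ω ∂μ, ∀ᶠ n in atTop, ∑ i ∈ Finset.range n,
      bitScore α σ ε l u (Z i ω) (inner ℝ (βhat n ω) (X i ω)) • X i ω = 0) :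
    TendstoInDistribution (fun (n : ℕ) ω => √n • (βhat n ω - βs)) atTop id
      (fun _ => μ) (multivariateGaussian 0 (fisherInfo α σ ε l u FX βs)⁻¹) := by
  have hW := tendstoInDistribution_score hα0 hα1 hσ hε hlu hmoment hpd hindep hlaw
  have hHlim := tendsto_averageHess hα0 hα1 hσ hε hlu hmoment hindep hlaw
  have hHm := aestronglyMeasurable_averageHess hα0 hα1 hσ hε hlu hmoment hlaw
  obtain ⟨J, hJ⟩ : ∃ J, J = Matrix.toEuclideanCLM (𝕜 := ℝ) (fisherInfo α σ ε l u FX βs)⁻¹ :=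
    ⟨_, rfl⟩
  obtain ⟨F, hF⟩ : ∃ F, F = Matrix.toEuclideanCLM (𝕜 := ℝ) (fisherInfo α σ ε l u FX βs) :=
    ⟨_, rfl⟩
  have hJF : J * F = 1 := by
    rw [hJ, hF, ← map_mul, Matrix.nonsing_inv_mul _
      ((Matrix.isUnit_iff_isUnit_det _).1 hpd.isUnit), map_one]
  rw [← hJ] at hW
  rw [← hF] at hHlim
  obtain ⟨K, hK0, hK, hL⟩ := exists_isBddLip_const (isBddLip_bitHess hα0 hα1 hσ hε hlu)
  have hlawX i : HasLaw (X i) FX μ := by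
    refine ⟨(hlaw i).aemeasurable.fst, ?_⟩
    rw [← map_fst_obsLaw hα0 hα1 hσ hε hlu FX βs, ← (hlaw i).map_eq,
      AEMeasurable.map_map_of_aemeasurable measurable_fst.aemeasurable (hlaw i).aemeasurable]
    rfl
  have hindepX : iIndepFun X μ := hindep.comp (fun _ w => w.1) fun _ => measurable_fst
  have hρlim : ∀ᵐ ω ∂μ, Tendsto (fun n =>
      averageRemainder K n (fun i => X i ω) ‖βhat n ω - βs‖) atTop (𝓝 0) := by
    refine tendsto_averageRemainder hmoment K hK0 hindepX hlawX (fun _ _ => norm_nonneg _) ?_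
    filter_upwards [hcons] with ω hω
    simpa using (hω.sub_const βs).norm
  have hηlim : ∀ᵐ ω ∂μ, Tendsto (fun n =>
      ‖J‖ * (‖averageHess α σ ε l u n (fun i => X i ω) (fun i => Z i ω) βs + F‖ +
        averageRemainder K n (fun i => X i ω) ‖βhat n ω - βs‖)) atTop (𝓝 0) := by
    filter_upwards [hρlim, hHlim] with ω h1 h2
    simpa using ((h2.add_const F).norm.add h1).const_mul ‖J‖
  refine tendstoInDistribution_of_norm_sub_le hW
    (η := fun n ω => 2 * (‖J‖ *
      (‖averageHess α σ ε l u n (fun i => X i ω) (fun i => Z i ω) βs + F‖ +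
        averageRemainder K n (fun i => X i ω) ‖βhat n ω - βs‖)))
    (fun n => ((hmeas n).sub_const βs).fun_const_smul _) (fun n => ?_) ?_ ?_
  · have hHn := ((hHm n).add (aestronglyMeasurable_const (b := F))).norm.aemeasurable
    have hρi i : AEMeasurable (fun ω =>
        K * min 2 (‖βhat n ω - βs‖ * ‖X i ω‖) * ‖X i ω‖ ^ 2) μ := by
      have := (hlawX i).aemeasurable
      have := hmeas n
      fun_prop
    have hρm : AEMeasurable (fun ω =>
        averageRemainder K n (fun i => X i ω) ‖βhat n ω - βs‖) μ :=
      (Finset.aemeasurable_fun_sum _ fun i _ => hρi i).const_mul _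
    exact ((hHn.add hρm).const_mul _).const_mul _
  · filter_upwards [hηlim] with ω hω
    simpa using hω.const_mul 2
  · filter_upwards [hηlim, hscore] with ω h1 h2
    filter_upwards [h1.eventually_le_const (show (0 : ℝ) < 1 / 2 by norm_num), h2]
      with n hn1 hn2
    exact norm_sqrt_smul_sub_le hα0 hα1 hσ hε hlu hK0 hK hL hJF hn2 hn1

end Normality

end OneBitQuantile

theorem mainTheorem7 {d : ℕ} (α σ ε l u : ℝ) (hα0 : 0 < α) (hα1 : α < 1) (hσ : 0 < σ)
    (hε : 0 < ε) (hlu : l < u)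
    -- distribution of the explanatory variables, with a density with respect to some measure
    (ν FX : Measure (EuclideanSpace ℝ (Fin d))) [IsProbabilityMeasure FX]
    (fX : EuclideanSpace ℝ (Fin d) → ℝ) (hfX_meas : Measurable fX) (hfX_nonneg : ∀ x, 0 ≤ fX x)
    (hfX : FX = ν.withDensity fun x => ENNReal.ofReal (fX x))
    (hentropy : Integrable (fun x => Real.log (fX x)) FX)
    (hmoment : Integrable (fun x => ‖x‖ ^ 2) FX)
    -- compact parameter set with the true parameter in its interior
    (B : Set (EuclideanSpace ℝ (Fin d))) (hB : IsCompact B)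
    (βs : EuclideanSpace ℝ (Fin d)) (hβs : βs ∈ interior B)
    -- the expected log-likelihood has a unique maximum
    (hunique : ∃! β, β ∈ B ∧
      IsMaxOn (OneBitQuantile.expLogLik α σ ε l u fX
        (OneBitQuantile.obsLaw α σ ε l u FX βs)) B β)
    -- independent copies of `(X, Y, Z)`
    {Ω : Type*} [MeasurableSpace Ω] (μ : Measure Ω) [IsProbabilityMeasure μ]
    (X : ℕ → Ω → EuclideanSpace ℝ (Fin d)) (Y : ℕ → Ω → ℝ) (Z : ℕ → Ω → Bool)
    (hindep : iIndepFun (fun i ω => (X i ω, Y i ω, Z i ω)) μ)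
    (hlaw : ∀ i, HasLaw (fun ω => (X i ω, Y i ω, Z i ω))
      (OneBitQuantile.jointLaw α σ ε l u FX βs) μ)
    -- maximum likelihood estimators
    (βhat : ℕ → Ω → EuclideanSpace ℝ (Fin d)) (hβhat_meas : ∀ n, AEMeasurable (βhat n) μ)
    (hβhat : ∀ n, ∀ᵐ ω ∂μ, βhat n ω ∈ B ∧
      IsMaxOn (OneBitQuantile.logLik α σ ε l u fX n (fun i => X i ω) (fun i => Z i ω)) B
        (βhat n ω)) :
    (∀ j k, Integrable (OneBitQuantile.fisherIntegrand α σ ε l u βs j k) FX) ∧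
    (OneBitQuantile.fisherInfo α σ ε l u FX βs).PosDef ∧
    TendstoInDistribution (fun (n : ℕ) ω => Real.sqrt n • (βhat n ω - βs)) atTop id
      (fun _ => μ)
      (multivariateGaussian 0 (OneBitQuantile.fisherInfo α σ ε l u FX βs)⁻¹) := by

  have hpd := OneBitQuantile.posDef_fisherInfo hα0 hα1 hσ hε hlu hentropy hmoment hβs hunique
  refine ⟨OneBitQuantile.integrable_fisherIntegrand hα0 hα1 hσ hε hlu hmoment βs, hpd, ?_⟩
  have hproj : Measurable fun w : EuclideanSpace ℝ (Fin d) × ℝ × Bool => (w.1, w.2.2) := by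
    fun_prop
  have hindep' : iIndepFun (fun i ω => (X i ω, Z i ω)) μ :=
    hindep.comp (fun _ w => (w.1, w.2.2)) fun _ => hproj
  have hlaw' i : HasLaw (fun ω => (X i ω, Z i ω)) (OneBitQuantile.obsLaw α σ ε l u FX βs) μ :=
    (⟨hproj.aemeasurable, rfl⟩ : HasLaw (fun w : EuclideanSpace ℝ (Fin d) × ℝ × Bool =>
      (w.1, w.2.2)) (OneBitQuantile.obsLaw α σ ε l u FX βs)
      (OneBitQuantile.jointLaw α σ ε l u FX βs)).fun_comp (hlaw i)
  have hcons := OneBitQuantile.tendsto_mle hα0 hα1 hσ hε hlu hfX_meas hentropy hmoment hB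
    (interior_subset hβs) hunique hindep' hlaw' hβhat
  refine OneBitQuantile.tendstoInDistribution_mle hα0 hα1 hσ hε hlu hmoment hpd hindep' hlaw'
    hβhat_meas hcons ?_
  filter_upwards [hcons, ae_all_iff.2 hβhat] with ω hω hmax
  filter_upwards [hω (isOpen_interior.mem_nhds hβs), eventually_ne_atTop 0] with n hn hn0
  exact OneBitQuantile.sum_bitScore_smul_eq_zero hα0 hα1 hσ hε hlu hn0 hn (hmax n).2
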